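/- Let $\mathbb C_+=\{s\in\mathbb C:\operatorname{Re}s>0\}$ and let $p_1=2,p_2=3,\dots$ be the primes. Let $f:\mathbb C_+\to\mathbb C$ belong to $\mathscr H^\infty$, i.e. $f$ is bounded and there are coefficients $a_n\in\mathbb C$ with $f(s)=\sum_{n=1}^\infty a_n n^{-s}$ (convergent) for every $s\in\mathbb C_+$. For $N\ge 1$ the Agler class $\mathcal A_N$ consists of the analytic functions $g:\mathbb D^N\to\overline{\mathbb D}$ such that $\|g(T)\|\le 1$ for every $N$-tuple $T$ of commuting operators of norm $<1$ on a complex Hilbert space, where $g(T)$ is defined by inserting $T$ in the absolutely convergent power series of $g$. The class $\mathcal A_\infty$ consists of the functions $F$ on the open unit ball of $c_{00}$ (finitely supported sequences, supremum norm) such that for every $N$ the function $(z_1,\dots,z_N)\mapsto F(z_1,\dots,z_N,0,0,\dots)$ belongs to $\mathcal A_N$. Such an $F$ has a unique holomorphic extension to the open unit ball of $c_0$, again denoted $F$. Let $\mathscr A^\infty$ be the set of all functions on $\mathbb C_+$ of the form $s\mapsto F(p_1^{-s},p_2^{-s},\dots)$ with $F\in\mathcal A_\infty$. The following are equivalent.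 1. $f\in\mathscr A^\infty$. 2. There are positive semi-definite kernels $K_1,K_2,\dots$ on $\mathbb C_+$ such that $\sum_{j=1}^\infty K_j(s,s)<\infty$ for every $s\in\mathbb C_+$ and $$1-f(s)\overline{f(w)}=\sum_{j=1}^\infty\bigl(1-p_j^{-(s+\bar w)}\bigr)K_j(s,w)\qquad(s,w\in\mathbb C_+).$$ (A function $K:\mathbb C_+\times\mathbb C_+\to\mathbb C$ is a positive semi-definite kernel if $\sum_{z,w\in Y}a(z)\overline{a(w)}K(z,w)\ge 0$ for every finite $Y\subset\mathbb C_+$ and every $a:Y\to\mathbb C$.) 3. For every $d$ and every diagonalizable matrix $M\in\mathbb C^{d\times d}$ with one-dimensional eigenspaces, with $\sigma(M)\subset\mathbb C_+$, and with $\|n^{-M}\|\le 1$ for all integers $n\ge 1$, one has $\|f(M)\|\le 1$. Here $\|\cdot\|$ is the operator norm for the Euclidean norm on $\mathbb C^d$, $n^{-M}=\exp(-(\log n)M)$, and $f(M)=P\,\mathrm{diag}(f(\lambda_1),\dots,f(\lambda_d))\,P^{-1}$ whenever $M=P\,\mathrm{diag}(\lambda_1,\dots,\lambda_d)\,P^{-1}$.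 -/

import Mathlib

open Filter Topology
open scoped ComplexOrder ComplexConjugate

noncomputable section

namespace DirichletAgler

/-- The `j`-th prime, counted from `j = 0`: `2, 3, 5, …`. -/
def prm (j : ℕ) : ℕ := Nat.nth Nat.Prime j

/-- The open right half plane `ℂ₊`. -/
def rightHalfPlane : Set ℂ := {s | 0 < s.re}

/-- `f` (only its values on `ℂ₊` matter) belongs to `ℋ^∞`: on `ℂ₊` it is the pointwise sum of a
(possibly only conditionally) convergent Dirichlet series `∑ aₙ n^{-s}`, and it is bounded there. -/
def MemHardyDirichlet (f : ℂ → ℂ) : Prop :=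
  (∃ a : ℕ → ℂ, ∀ s ∈ rightHalfPlane,
    Tendsto (fun N : ℕ => ∑ n ∈ Finset.Icc 1 N, a n * (n : ℂ) ^ (-s)) atTop (𝓝 (f s))) ∧
  ∃ C : ℝ, ∀ s ∈ rightHalfPlane, ‖f s‖ ≤ C

/-! ### The Agler class in finitely many variables -/

/-- The Schur class in `N` variables.  The norm of `Fin N → ℂ` is the sup norm, so
`Metric.ball 0 1` is the open unit polydisk. -/
structure MemSchur (N : ℕ) (f : (Fin N → ℂ) → ℂ) : Prop where
  analytic : AnalyticOnNhd ℂ f (Metric.ball 0 1)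
  bounded : ∀ z ∈ Metric.ball (0 : Fin N → ℂ) 1, ‖f z‖ ≤ 1

/-- `f(z) = ∑_α c_α z^α` for every `z` in the polydisk, with absolute (that is, unconditional)
convergence. -/
def HasPolydiskSeries {N : ℕ} (f : (Fin N → ℂ) → ℂ) (c : (Fin N → ℕ) → ℂ) : Prop :=
  ∀ z ∈ Metric.ball (0 : Fin N → ℂ) 1, HasSum (fun α => c α * ∏ i, z i ^ α i) (f z)

/-- The operator monomial `T^α = T₁^{α₁} ⋯ T_N^{α_N}`. -/
def opMonomial {N : ℕ} {H : Type*} [NormedAddCommGroup H] [InnerProductSpace ℂ H]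
    (T : Fin N → H →L[ℂ] H) (α : Fin N → ℕ) : H →L[ℂ] H :=
  (List.ofFn fun i => T i ^ α i).prod

/-- The Agler class in `N` variables: Schur class functions such that `‖f(T)‖ ≤ 1` for every
tuple `T` of commuting strict contractions on a Hilbert space, where
`f(T) = ∑_α c_α T^α` (absolutely convergent) comes from the unique power series of `f`.
Since `‖f(T)x‖` only involves the separable subspace generated by `x` under the `T_i`,
Hilbert spaces in `Type` give the same class as those in any other universe. -/
structure MemAgler (N : ℕ) (f : (Fin N → ℂ) → ℂ) : Prop extends MemSchur N f where
  vonNeumann : ∃ c : (Fin N → ℕ) → ℂ, HasPolydiskSeries f c ∧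
    ∀ (H : Type) [NormedAddCommGroup H] [InnerProductSpace ℂ H] [CompleteSpace H]
      (T : Fin N → H →L[ℂ] H),
      (∀ i, ‖T i‖ < 1) → (∀ i j, Commute (T i) (T j)) →
        Summable (fun α => ‖c α • opMonomial T α‖) ∧ ‖∑' α, c α • opMonomial T α‖ ≤ 1

/-! ### The Agler class in infinitely many variables and its Bohr image -/

/-- The point `(z₁, …, z_N, 0, 0, …)`. -/
def padZero {N : ℕ} (z : Fin N → ℂ) : ℕ → ℂ :=
  fun j => if h : j < N then z ⟨j, h⟩ else 0

/-- The Agler class in infinitely many variables.  Only the values of `F` on the unit ball of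
`c₀₀` matter: this ball is the union of the polydisks `𝔻^N × {(0, 0, …)}`. -/
def MemAglerInfty (F : (ℕ → ℂ) → ℂ) : Prop :=
  ∀ N : ℕ, MemAgler N (fun z => F (padZero z))

lemma tendsto_prm_cpow {s : ℂ} (hs : 0 < s.re) :
    Tendsto (fun j => (prm j : ℂ) ^ (-s)) atTop (𝓝 0) := by
  have h1 : Tendsto prm atTop atTop :=
    (Nat.nth_strictMono Nat.infinite_setOfPred_prime).tendsto_atTop
  rw [tendsto_zero_iff_norm_tendsto_zero]
  have h2 : Tendsto (fun j => ((prm j : ℕ) : ℝ) ^ (-s.re)) atTop (𝓝 0) :=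
    (tendsto_rpow_neg_atTop hs).comp (tendsto_natCast_atTop_atTop.comp h1)
  refine h2.congr fun j => ?_
  have hp : 0 < prm j := (Nat.prime_nth_prime j).pos
  rw [Complex.norm_natCast_cpow_of_pos hp, Complex.neg_re]

/-- The point `(p₁^{-s}, p₂^{-s}, …)` of `c₀`, the space of null sequences with the sup norm. -/
def primePoint (s : ℂ) (hs : s ∈ rightHalfPlane) : ZeroAtInftyContinuousMap ℕ ℂ where
  toFun j := (prm j : ℂ) ^ (-s)
  continuous_toFun := continuous_of_discreteTopology
  zero_at_infty' := by
    rw [Filter.cocompact_eq_cofinite, Nat.cofinite_eq_atTop]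
    exact tendsto_prm_cpow hs

/-- `f ∈ 𝒜^∞`: there is `F` in the Agler class in infinitely many variables whose (unique)
holomorphic extension `G` from the unit ball of `c₀₀` to the unit ball of `c₀` satisfies
`f(s) = G(p₁^{-s}, p₂^{-s}, …)` on `ℂ₊`. -/
def MemBohrAgler (f : ℂ → ℂ) : Prop :=
  ∃ F : (ℕ → ℂ) → ℂ, MemAglerInfty F ∧
    ∃ G : ZeroAtInftyContinuousMap ℕ ℂ → ℂ,
      DifferentiableOn ℂ G (Metric.ball 0 1) ∧
      (∀ z ∈ Metric.ball (0 : ZeroAtInftyContinuousMap ℕ ℂ) 1,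
        (Function.support (z : ℕ → ℂ)).Finite → G z = F z) ∧
      ∀ (s : ℂ) (hs : s ∈ rightHalfPlane), f s = G (primePoint s hs)

/-! ### Positive semi-definite kernels and Agler decompositions -/

/-- Positive semi-definite kernels on a set `X`; `0 ≤ ζ` for complex `ζ` means that `ζ` is real
and nonnegative. -/
def IsPSDOn (X : Set ℂ) (A : ℂ → ℂ → ℂ) : Prop :=
  ∀ Y : Finset ℂ, (Y : Set ℂ) ⊆ X → ∀ a : ℂ → ℂ,
    0 ≤ ∑ z ∈ Y, ∑ w ∈ Y, a z * conj (a w) * A z w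

/-- `1 - f(s) conj(f(w)) = ∑_j (1 - p_j^{-(s + conj w)}) K_j(s, w)` on `ℂ₊` with positive
semi-definite kernels `K_j` such that `∑_j K_j(s, s) < ∞`. -/
def HasAglerDecomposition (f : ℂ → ℂ) : Prop :=
  ∃ K : ℕ → ℂ → ℂ → ℂ,
    (∀ j, IsPSDOn rightHalfPlane (K j)) ∧
    (∀ s ∈ rightHalfPlane, ∀ w ∈ rightHalfPlane,
      HasSum (fun j => (1 - (prm j : ℂ) ^ (-(s + conj w))) * K j s w) (1 - f s * conj (f w))) ∧
    ∀ s ∈ rightHalfPlane, Summable (fun j => K j s s)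

/-! ### Matrices -/

/-- The operator norm of a matrix acting on `ℂ^d` with its Euclidean norm. -/
def opNorm {d : ℕ} (M : Matrix (Fin d) (Fin d) ℂ) : ℝ :=
  ‖Matrix.toEuclideanCLM (n := Fin d) (𝕜 := ℂ) M‖

/-- `M` is similar to a diagonal matrix. -/
def IsDiagonalizable {d : ℕ} (M : Matrix (Fin d) (Fin d) ℂ) : Prop :=
  ∃ (P : Matrix (Fin d) (Fin d) ℂ) (l : Fin d → ℂ),
    IsUnit P.det ∧ M = P * Matrix.diagonal l * P⁻¹

/-- All eigenspaces of `M` are one-dimensional. -/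
def HasSimpleEigenspaces {d : ℕ} (M : Matrix (Fin d) (Fin d) ℂ) : Prop :=
  ∀ μ : ℂ, Module.End.HasEigenvalue (Matrix.toLin' M) μ →
    Module.finrank ℂ (Module.End.eigenspace (Matrix.toLin' M) μ) = 1

/-- `n^{-M} = exp(-(log n) M)`. -/
def natPowNeg {d : ℕ} (n : ℕ) (M : Matrix (Fin d) (Fin d) ℂ) : Matrix (Fin d) (Fin d) ℂ :=
  NormedSpace.exp (-((Real.log n : ℝ) : ℂ) • M)

/-- `f(M)` for a diagonalizable matrix `M`: the value at `M` of the polynomial that interpolates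
`f` on the set of eigenvalues of `M`.  See `funMatrix_conj_diagonal`. -/
def funMatrix {d : ℕ} (f : ℂ → ℂ) (M : Matrix (Fin d) (Fin d) ℂ) : Matrix (Fin d) (Fin d) ℂ :=
  Polynomial.aeval M (Lagrange.interpolate M.charpoly.roots.toFinset id f)

lemma aeval_conj_diagonal {d : ℕ} (q : Polynomial ℂ) (P : Matrix (Fin d) (Fin d) ℂ)
    (hP : IsUnit P.det) (l : Fin d → ℂ) :
    Polynomial.aeval (P * Matrix.diagonal l * P⁻¹) q =
      P * Matrix.diagonal (fun i => q.eval (l i)) * P⁻¹ := by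
  induction q using Polynomial.induction_on' with
  | add p q hp hq =>
    simp only [map_add, hp, hq, Polynomial.eval_add, ← Matrix.diagonal_add, mul_add, add_mul]
  | monomial n c =>
    have hpow : (P * Matrix.diagonal l * P⁻¹) ^ n = P * Matrix.diagonal (l ^ n) * P⁻¹ := by
      induction n with
      | zero => simp [Matrix.mul_nonsing_inv P hP]
      | succ n ih =>
        rw [pow_succ, ih, pow_succ]
        calc P * Matrix.diagonal (l ^ n) * P⁻¹ * (P * Matrix.diagonal l * P⁻¹)
            = P * Matrix.diagonal (l ^ n) * (P⁻¹ * P) * Matrix.diagonal l * P⁻¹ := by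
              simp only [mul_assoc]
          _ = _ := by
              rw [Matrix.nonsing_inv_mul P hP, mul_one, mul_assoc P, Matrix.diagonal_mul_diagonal]
              rfl
    rw [Polynomial.aeval_monomial, hpow, ← Algebra.smul_def]
    have : (fun i => Polynomial.eval (l i) (Polynomial.monomial n c)) = c • l ^ n := by
      ext i; simp
    rw [this, Matrix.diagonal_smul, Matrix.mul_smul, Matrix.smul_mul]

/-- `f(P diag(l) P⁻¹) = P diag(f(l)) P⁻¹`, whatever diagonalization is used. -/
lemma funMatrix_conj_diagonal {d : ℕ} (f : ℂ → ℂ) (P : Matrix (Fin d) (Fin d) ℂ)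
    (hP : IsUnit P.det) (l : Fin d → ℂ) :
    funMatrix f (P * Matrix.diagonal l * P⁻¹) =
      P * Matrix.diagonal (fun i => f (l i)) * P⁻¹ := by
  have hPu : IsUnit P := (Matrix.isUnit_iff_isUnit_det P).2 hP
  have hchar : (P * Matrix.diagonal l * P⁻¹).charpoly = (Matrix.diagonal l).charpoly := by
    obtain ⟨u, rfl⟩ := hPu
    simpa only [Matrix.coe_units_inv] using Matrix.charpoly_units_conj u (Matrix.diagonal l)
  rw [funMatrix, aeval_conj_diagonal _ P hP]
  congr 3
  ext i
  refine Lagrange.eval_interpolate_at_node f (Function.injective_id.injOn) ?_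
  rw [hchar, Matrix.charpoly_diagonal, Multiset.mem_toFinset, Polynomial.mem_roots]
  · simp [Polynomial.IsRoot, Polynomial.eval_prod, Finset.prod_eq_zero_iff, sub_eq_zero]
  · exact Finset.prod_ne_zero_iff.2 fun j _ => Polynomial.X_sub_C_ne_zero _

/-- The matrix von Neumann inequality for `f`. -/
def SatisfiesMatrixVonNeumann (f : ℂ → ℂ) : Prop :=
  ∀ (d : ℕ) (M : Matrix (Fin d) (Fin d) ℂ),
    IsDiagonalizable M → HasSimpleEigenspaces M → spectrum ℂ M ⊆ rightHalfPlane →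
    (∀ n : ℕ, 1 ≤ n → opNorm (natPowNeg n M) ≤ 1) →
    opNorm (funMatrix f M) ≤ 1

end DirichletAgler

end

noncomputable section

namespace DirichletAgler

/-! The equivalence is proved around the cycle 1 → 3 → 2 → 1.

1 → 3. If `M` has eigenvalues `l i`, the matrices `p_j^{-M}` are commuting contractions. Truncating
to `N` primes and scaling by `1 - 1/(N+1)` makes them strict contractions, to which the Agler
inequality in `N` variables applies. Continuity of the extension `G` on the ball of `c₀` lets `N →
∞`.

3 → 2. On a finite set of points, suppose the kernel `1 - f(s) conj(f(w))` lies outside the closed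
cone of decomposable kernels. A separating functional, perturbed by a small multiple of the trace,
is represented by a positive definite matrix `Γ = R* R`. For `M = R diag(l) R⁻¹`, nonnegativity on
the cone says exactly that every `p_j^{-M}` is a contraction, while negativity at `1 - f conj(f)`
contradicts `‖f(M)‖ ≤ 1` (`mem_closure_decomposableCone`). An ultrafilter limit over finite sets
then gives kernels on the half plane. Mass that escapes to `j = ∞` leaves a positive semi-definite
remainder because `p_j^{-s} → 0`, and it is absorbed into the first kernel
(`exists_decomposition_of_approx`).

2 → 1. Writing the `K_j` as Gram kernels, the decomposition says that `(1, Z(s) κ_s) ↦ (f(s), κ_s)`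
preserves inner products (the lurking isometry), so it extends to a contraction with blocks `a, B,
c, D`. Solving for `κ_s` gives `f = a + B Z (1 - D Z)⁻¹ c`, which makes sense on the whole ball of
`c₀` (`memBohrAgler_of_gram`). Its restrictions to finitely many variables are in the Agler class by
an energy estimate for the recursion that generates the power series (`sum_pairing_partialSum_le`,
`memAgler_transfer`). -/

open Matrix in
/-- Positive semi-definiteness tested on finite sets of indices. -/
theorem posSemidef_iff_finset {ι : Type*} {M : Matrix ι ι ℂ} :
    M.PosSemidef ↔ ∀ (s : Finset ι) (a : ι → ℂ),
      0 ≤ ∑ i ∈ s, ∑ j ∈ s, a i * conj (a j) * M i j := by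
  classical
  constructor
  · intro h s a
    have := h.2 (Finsupp.onFinset s (fun i => if i ∈ s then conj (a i) else 0)
      (by simp +contextual))
    rw [Finsupp.onFinset_sum _ (by simp)] at this
    convert this using 1
    refine Finset.sum_congr rfl fun i hi => ?_
    rw [Finsupp.onFinset_sum _ (by simp)]
    refine Finset.sum_congr rfl fun j hj => ?_
    simp [hi, hj]; ring
  · intro h
    refine ⟨?_, fun x => ?_⟩
    · ext i j
      rw [conjTranspose_apply, Complex.star_def]
      have hd : ∀ i, (M i i).im = 0 := fun i => by
        have := h {i} 1
        simp at this
        exact (Complex.le_def.1 this).2.symm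
      by_cases hij : i = j
      · subst hij
        exact Complex.conj_eq_iff_im.2 (hd i)
      -- The test vectors `(1, 1)` and `(1, I)` force opposite imaginary parts and equal real parts
      -- of `M i j` and `M j i`.
      have h1 := h {i, j} 1
      have h2 := h {i, j} (fun k => if k = i then 1 else Complex.I)
      simp only [Finset.sum_pair hij, Pi.one_apply, map_one, one_mul] at h1 h2
      simp only [if_true, if_neg (Ne.symm hij)] at h2
      have e1 := (Complex.le_def.1 h1).2
      have e2 := (Complex.le_def.1 h2).2
      simp [hd] at e1 e2
      apply Complex.ext <;> simp <;> linarith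
    · have := h x.support (fun i => conj (x i))
      convert this using 1
      refine Finset.sum_congr rfl fun i hi => Finset.sum_congr rfl fun j hj => ?_
      simp; ring

theorem isPSDOn_iff {X : Set ℂ} {A : ℂ → ℂ → ℂ} :
    IsPSDOn X A ↔ (Matrix.of fun z w : X => A z w).PosSemidef := by
  classical
  rw [posSemidef_iff_finset]
  constructor
  · intro h s a
    have := h (s.map (Function.Embedding.subtype _)) (by
      intro x hx
      simp at hx
      exact hx.1) (fun z => if hz : z ∈ X then a ⟨z, hz⟩ else 0)
    simpa using this
  · intro h Y hY a
    have := h (Y.subtype (· ∈ X)) (fun z => a z)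
    have e : ∀ f : ℂ → ℂ, ∑ z ∈ Y.subtype (· ∈ X), f z = ∑ z ∈ Y, f z := fun f =>
      Finset.sum_subtype_of_mem f (fun x hx => hY hx)
    simp only [Matrix.of_apply] at this
    rw [e (fun z => ∑ w ∈ Y.subtype (· ∈ X), a z * conj (a w) * A z w)] at this
    refine this.trans_eq (Finset.sum_congr rfl fun z _ => ?_)
    exact e (fun w => a z * conj (a w) * A z w)

/-- A pointwise limit of positive semi-definite kernels is positive semi-definite. -/
theorem posSemidef_of_tendsto {ι κ : Type*} {l : Filter κ} [l.NeBot]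
    {M : κ → Matrix ι ι ℂ} {N : Matrix ι ι ℂ} (hM : ∀ᶠ k in l, (M k).PosSemidef)
    (h : ∀ i j, Tendsto (fun k => M k i j) l (𝓝 (N i j))) : N.PosSemidef := by
  rw [posSemidef_iff_finset]
  intro s a
  refine ge_of_tendsto (tendsto_finsetSum _ fun i _ => tendsto_finsetSum _ fun j _ =>
    (h i j).const_mul (a i * conj (a j))) ?_
  filter_upwards [hM] with k hk using posSemidef_iff_finset.1 hk s a

/-! ### Gram kernels and the Szegő kernel -/

section Gram

variable {ι E F : Type*} [NormedAddCommGroup E] [InnerProductSpace ℂ E]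
  [NormedAddCommGroup F] [InnerProductSpace ℂ F]

theorem sum_star_inner_mul (x : ι →₀ ℂ) (v : ι → E) :
    (x.sum fun i xi => x.sum fun j xj => star xi * inner ℂ (v i) (v j) * xj) =
      ((‖Finsupp.linearCombination ℂ v x‖ ^ 2 : ℝ) : ℂ) := by
  have e : ∀ y : E, ((‖y‖ ^ 2 : ℝ) : ℂ) = inner ℂ y y := fun y => by
    rw [inner_self_eq_norm_sq_to_K, Complex.ofReal_pow]; rfl
  rw [e, Finsupp.linearCombination_apply, Finsupp.sum_inner]
  refine Finsupp.sum_congr fun i _ => ?_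
  rw [Finsupp.inner_sum]
  refine Finsupp.sum_congr fun j _ => ?_
  simp [inner_smul_left, inner_smul_right]; ring

/-- A difference of Gram kernels is positive semi-definite if `v i ↦ w i` is contractive. -/
theorem posSemidef_inner_sub_inner (v : ι → E) (w : ι → F)
    (h : ∀ x : ι →₀ ℂ, ‖Finsupp.linearCombination ℂ w x‖ ≤ ‖Finsupp.linearCombination ℂ v x‖) :
    (Matrix.of fun i j => inner ℂ (v i) (v j) - inner ℂ (w i) (w j)).PosSemidef := by
  refine ⟨?_, fun x => ?_⟩
  · ext i j
    simp [Matrix.conjTranspose_apply]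
  · have : (x.sum fun i xi => x.sum fun j xj => star xi *
        (Matrix.of fun i j => inner ℂ (v i) (v j) - inner ℂ (w i) (w j)) i j * xj) =
        ((‖Finsupp.linearCombination ℂ v x‖ ^ 2 -
          ‖Finsupp.linearCombination ℂ w x‖ ^ 2 : ℝ) : ℂ) := by
      rw [Complex.ofReal_sub, ← sum_star_inner_mul, ← sum_star_inner_mul, ← Finsupp.sum_sub]
      refine Finsupp.sum_congr fun i _ => ?_
      rw [← Finsupp.sum_sub]
      refine Finsupp.sum_congr fun j _ => ?_
      simp; ring
    rw [this]
    exact_mod_cast sub_nonneg.2 (pow_le_pow_left₀ (norm_nonneg _) (h x) 2)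

theorem posSemidef_inner (v : ι → E) :
    (Matrix.of fun i j => inner ℂ (v i) (v j)).PosSemidef := by
  simpa using posSemidef_inner_sub_inner v (fun _ => (0 : E)) (fun x => by
    simp [Finsupp.linearCombination_apply])

end Gram

/-- The geometric series is a limit of sums of rank-one Gram kernels. Together with the Schur
product theorem this permits division by `1 - q conj(q)` without losing positivity. -/
theorem posSemidef_one_sub_inv {ι : Type*} (q : ι → ℂ) (hq : ∀ i, ‖q i‖ < 1) :
    (Matrix.of fun i j => (1 - q i * conj (q j))⁻¹).PosSemidef := by
  refine posSemidef_of_tendsto (l := atTop)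
    (M := fun n : ℕ => Matrix.of fun i j => ∑ k ∈ Finset.range n, (q i * conj (q j)) ^ k) ?_ ?_
  · refine Eventually.of_forall fun n => ?_
    have : (Matrix.of fun i j => ∑ k ∈ Finset.range n, (q i * conj (q j)) ^ k) =
        ∑ k ∈ Finset.range n, Matrix.of fun i j => inner ℂ (conj (q i) ^ k) (conj (q j) ^ k) := by
      ext i j
      simp [Matrix.sum_apply, mul_pow]
      exact Finset.sum_congr rfl fun _ _ => mul_comm _ _
    rw [this]
    exact Matrix.posSemidef_sum _ fun k _ => posSemidef_inner fun i => conj (q i) ^ k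
  · intro i j
    have : ‖q i * conj (q j)‖ < 1 := by
      rw [norm_mul, RCLike.norm_conj]
      exact mul_lt_one_of_nonneg_of_lt_one_left (norm_nonneg _) (hq i) (hq j).le
    exact (hasSum_geometric_of_norm_lt_one this).tendsto_sum_nat

/-! ### Polynomials with coefficients in a Hilbert space -/

section Pairing

variable {ι E F : Type*} [NormedAddCommGroup E] [InnerProductSpace ℂ E]
  [NormedAddCommGroup F] [InnerProductSpace ℂ F]

/-- The sesquilinear form `∑ ⟪u α, v β⟫ g α β` on finitely supported families of vectors. -/
def pairing (g : Matrix ι ι ℂ) (u v : ι →₀ E) : ℂ :=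
  u.sum fun α h => v.sum fun β k => inner ℂ h k * g α β

theorem pairing_eq_sum (g : Matrix ι ι ℂ) {u v : ι →₀ E} {s : Finset ι}
    (hu : u.support ⊆ s) (hv : v.support ⊆ s) :
    pairing g u v = ∑ α ∈ s, ∑ β ∈ s, inner ℂ (u α) (v β) * g α β := by
  rw [pairing, Finsupp.sum_of_support_subset u hu _ (by simp)]
  refine Finset.sum_congr rfl fun α _ => ?_
  rw [Finsupp.sum_of_support_subset v hv _ (by simp)]

theorem pairing_finsetSum (g : Matrix ι ι ℂ) {κ : Type*} (s : Finset κ) (u v : κ → ι →₀ E) :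
    pairing g (∑ i ∈ s, u i) (∑ j ∈ s, v j) = ∑ i ∈ s, ∑ j ∈ s, pairing g (u i) (v j) := by
  have e : ∀ w, pairing g (∑ i ∈ s, u i) w = ∑ i ∈ s, pairing g (u i) w := fun w =>
    (Finsupp.sum_finsetSum_index (h := fun α h => w.sum fun β k => inner ℂ h k * g α β) (by simp)
      (fun α h k => by simp only [inner_add_left, add_mul, Finsupp.sum_add])).symm
  rw [e]
  refine Finset.sum_congr rfl fun i _ => ?_
  have e' : ∀ α h, (∑ j ∈ s, v j).sum (fun β k => inner ℂ h k * g α β) =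
      ∑ j ∈ s, (v j).sum fun β k => inner ℂ h k * g α β := fun α h =>
    (Finsupp.sum_finsetSum_index (h := fun β k => inner ℂ h k * g α β) (by simp)
      (fun α h k => by simp only [inner_add_right, add_mul])).symm
  simp only [pairing, e']
  exact (Finset.sum_comm (s := (u i).support) (t := s) (f := fun α j => (v j).sum fun β k =>
    inner ℂ (u i α) k * g α β))

theorem pairing_mapDomain (g : Matrix ι ι ℂ) (φ ψ : ι → ι) (u v : ι →₀ E) :
    pairing g (u.mapDomain φ) (v.mapDomain ψ) =
      pairing (Matrix.of fun α β => g (φ α) (ψ β)) u v := by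
  unfold pairing
  rw [Finsupp.sum_mapDomain_index (by simp)
    (fun α h k => by simp only [inner_add_left, add_mul, Finsupp.sum_add])]
  refine Finsupp.sum_congr fun α _ => ?_
  rw [Finsupp.sum_mapDomain_index (by simp)
    (fun α h k => by simp only [inner_add_right, add_mul])]
  rfl

theorem pairing_mapRange (g : Matrix ι ι ℂ) (A A' : E →ₗ[ℂ] F) (u v : ι →₀ E) :
    pairing g (Finsupp.mapRange.linearMap A u) (Finsupp.mapRange.linearMap A' v) =
      u.sum fun α h => v.sum fun β k => inner ℂ (A h) (A' k) * g α β := by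
  unfold pairing
  rw [Finsupp.mapRange.linearMap_apply, Finsupp.mapRange.linearMap_apply,
    Finsupp.sum_mapRange_index (by simp)]
  refine Finsupp.sum_congr fun α _ => ?_
  rw [Finsupp.sum_mapRange_index (by simp)]

/-- The Schur product theorem, tested on the constant vector `1`. -/
theorem sum_hadamard_nonneg {M g : Matrix ι ι ℂ} (hM : M.PosSemidef) (hg : g.PosSemidef)
    (s : Finset ι) : 0 ≤ ∑ α ∈ s, ∑ β ∈ s, M α β * g α β := by
  simpa using posSemidef_iff_finset.1 (hM.hadamard hg) s 1

theorem pairing_self_nonneg {g : Matrix ι ι ℂ} (hg : g.PosSemidef) (u : ι →₀ E) :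
    0 ≤ pairing g u u := by
  rw [pairing_eq_sum g subset_rfl subset_rfl]
  exact sum_hadamard_nonneg (posSemidef_inner u) hg _

/-- This is how operators enter: with `x α = T^α x₀`, the self-pairing of a scalar polynomial `p` is
`‖p(T) x₀‖²`. -/
theorem pairing_inner (x : ι → F) (u : ι →₀ ℂ) :
    pairing (Matrix.of fun α β => inner ℂ (x α) (x β)) u u =
      ((‖u.sum fun α t => t • x α‖ ^ 2 : ℝ) : ℂ) := by
  rw [← Finsupp.linearCombination_apply, ← sum_star_inner_mul, pairing]
  refine Finsupp.sum_congr fun α _ => Finsupp.sum_congr fun β _ => ?_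
  simp; ring

end Pairing

/-! ### Contractive colligations and their transfer functions -/

/-- A contraction `(t, h) ↦ (a t + B h, t c + D h)` of `ℂ ⊕ 𝓗` together with operators
`E₁, …, E_N` that have pairwise orthogonal ranges and satisfy `∑ ‖E_i h‖² ≤ ‖h‖²`. -/
structure Colligation (N : ℕ) (𝓗 : Type*) [NormedAddCommGroup 𝓗] [InnerProductSpace ℂ 𝓗] where
  a : ℂ
  B : 𝓗 →L[ℂ] ℂ
  c : 𝓗
  D : 𝓗 →L[ℂ] 𝓗
  E : Fin N → 𝓗 →L[ℂ] 𝓗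
  contractive : ∀ (t : ℂ) (h : 𝓗),
    ‖t * a + B h‖ ^ 2 + ‖t • c + D h‖ ^ 2 ≤ ‖t‖ ^ 2 + ‖h‖ ^ 2
  orthogonal : ∀ i j, i ≠ j → ∀ h k, inner ℂ (E i h) (E j k) = 0
  sum_norm_sq_le : ∀ h, ∑ i, ‖E i h‖ ^ 2 ≤ ‖h‖ ^ 2

namespace Colligation

variable {N : ℕ} {𝓗 : Type*} [NormedAddCommGroup 𝓗] [InnerProductSpace ℂ 𝓗]
  (S : Colligation N 𝓗)

/-- Multiplication of an `𝓗`-valued polynomial by `∑ z_i E_i`. -/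
def shift : ((Fin N → ℕ) →₀ 𝓗) →ₗ[ℂ] ((Fin N → ℕ) →₀ 𝓗) :=
  ∑ i, Finsupp.lmapDomain 𝓗 ℂ (· + Pi.single i 1) ∘ₗ
    Finsupp.mapRange.linearMap (S.E i : 𝓗 →ₗ[ℂ] 𝓗)

theorem shift_apply (u : (Fin N → ℕ) →₀ 𝓗) : S.shift u =
    ∑ i, (Finsupp.mapRange.linearMap (S.E i : 𝓗 →ₗ[ℂ] 𝓗) u).mapDomain (· + Pi.single i 1) := by
  simp [shift]

theorem exists_of_shift_apply_ne_zero {u : (Fin N → ℕ) →₀ 𝓗} {β : Fin N → ℕ}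
    (h : S.shift u β ≠ 0) : ∃ i α, u α ≠ 0 ∧ β = α + Pi.single i 1 := by
  classical
  rw [shift_apply, Finsupp.finsetSum_apply] at h
  obtain ⟨i, -, hi⟩ := Finset.exists_ne_zero_of_sum_ne_zero h
  have := Finsupp.mapDomain_support (Finsupp.mem_support_iff.2 hi)
  obtain ⟨α, hα, rfl⟩ := Finset.mem_image.1 this
  refine ⟨i, α, fun h0 => ?_, rfl⟩
  simp [h0] at hα

/-- Partial sums of the power series of `(1 - D ∑ z_i E_i)⁻¹ c`. -/
def state : ℕ → (Fin N → ℕ) →₀ 𝓗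
  | 0 => 0
  | n + 1 => Finsupp.single 0 S.c +
      Finsupp.mapRange.linearMap (S.D : 𝓗 →ₗ[ℂ] 𝓗) (S.shift (state n))

/-- Partial sums of the power series of the transfer function. -/
def partialSum (n : ℕ) : (Fin N → ℕ) →₀ ℂ :=
  Finsupp.single 0 S.a + Finsupp.mapRange.linearMap (S.B : 𝓗 →ₗ[ℂ] ℂ) (S.shift (S.state n))

/-- The power series coefficients of the transfer function. -/
def coeff (α : Fin N → ℕ) : ℂ := S.partialSum (∑ i, α i) α

/-- The increment is `(D Z)^n c` with `Z = ∑ z_i E_i`, homogeneous of degree `n`. Hence each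
coefficient of the partial sums is settled after finitely many steps. -/
theorem state_succ_sub_apply (n : ℕ) (α : Fin N → ℕ) (hα : ∑ i, α i ≠ n) :
    (S.state (n + 1) - S.state n) α = 0 := by
  induction n generalizing α with
  | zero =>
    have : α ≠ 0 := by rintro rfl; simp at hα
    simp [state, this.symm]
  | succ n ih =>
    have : S.state (n + 1 + 1) - S.state (n + 1) = Finsupp.mapRange.linearMap
        (S.D : 𝓗 →ₗ[ℂ] 𝓗) (S.shift (S.state (n + 1) - S.state n)) := by
      rw [map_sub, map_sub, state, state]; abel
    rw [this]
    by_contra h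
    have h' : S.shift (S.state (n + 1) - S.state n) α ≠ 0 := fun h0 => h (by
      rw [Finsupp.mapRange.linearMap_apply, Finsupp.mapRange_apply, h0, map_zero])
    obtain ⟨i, β, hβ, rfl⟩ := S.exists_of_shift_apply_ne_zero h'
    refine hβ (ih β fun hn => hα ?_)
    simp [Finset.sum_add_distrib, hn]

theorem partialSum_succ_apply (n : ℕ) (α : Fin N → ℕ) (hα : ∑ i, α i ≠ n + 1) :
    S.partialSum (n + 1) α = S.partialSum n α := by
  rw [← sub_eq_zero, ← Finsupp.sub_apply]
  have : S.partialSum (n + 1) - S.partialSum n = Finsupp.mapRange.linearMap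
        (S.B : 𝓗 →ₗ[ℂ] ℂ) (S.shift (S.state (n + 1) - S.state n)) := by
    rw [map_sub, map_sub, partialSum, partialSum]; abel
  rw [this]
  by_contra h
  have h' : S.shift (S.state (n + 1) - S.state n) α ≠ 0 := fun h0 => h (by
      rw [Finsupp.mapRange.linearMap_apply, Finsupp.mapRange_apply, h0, map_zero])
  obtain ⟨i, β, hβ, rfl⟩ := S.exists_of_shift_apply_ne_zero h'
  refine hβ (S.state_succ_sub_apply n β fun hn => hα ?_)
  simp [Finset.sum_add_distrib, hn]

theorem partialSum_apply_of_lt {n : ℕ} {α : Fin N → ℕ} (hα : n < ∑ i, α i) :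
    S.partialSum n α = 0 := by
  induction n with
  | zero =>
    have : α ≠ 0 := by rintro rfl; simp at hα
    simp [partialSum, state, this.symm]
  | succ n ih => rw [S.partialSum_succ_apply n α hα.ne', ih (by lia)]

theorem partialSum_apply_of_le {n : ℕ} {α : Fin N → ℕ} (hα : ∑ i, α i ≤ n) :
    S.partialSum n α = S.coeff α := by
  induction n, hα using Nat.le_induction with
  | base => rfl
  | succ n hn ih => rw [S.partialSum_succ_apply n α (by lia), ih]

/-! #### The energy inequality -/

variable {g : Matrix (Fin N → ℕ) (Fin N → ℕ) ℂ}

/-- Orthogonality of the ranges of the `E i` removes the cross terms, `hgs` makes multiplication by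
each single variable contractive for `g`, and `∑ ‖E_i h‖² ≤ ‖h‖²`, combined with the Schur product,
sums up what is left. -/
theorem pairing_shift_le (hg : g.PosSemidef)
    (hgs : ∀ i : Fin N, (g - Matrix.of fun α β =>
      g (α + Pi.single i 1) (β + Pi.single i 1)).PosSemidef) (u : (Fin N → ℕ) →₀ 𝓗) :
    pairing g (S.shift u) (S.shift u) ≤ pairing g u u := by
  have h1 : pairing g (S.shift u) (S.shift u) = ∑ i, ∑ α ∈ u.support, ∑ β ∈ u.support,
      inner ℂ (S.E i (u α)) (S.E i (u β)) * g (α + Pi.single i 1) (β + Pi.single i 1) := by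
    rw [shift_apply, pairing_finsetSum]
    refine Finset.sum_congr rfl fun i _ => ?_
    simp only [pairing_mapDomain, pairing_mapRange]
    rw [Finset.sum_eq_single i]
    · rfl
    · intro j _ hji
      simp [S.orthogonal i j hji.symm]
    · simp
  have h2 : ∀ i, ∑ α ∈ u.support, ∑ β ∈ u.support,
      inner ℂ (S.E i (u α)) (S.E i (u β)) * g (α + Pi.single i 1) (β + Pi.single i 1) ≤
      ∑ α ∈ u.support, ∑ β ∈ u.support, inner ℂ (S.E i (u α)) (S.E i (u β)) * g α β := by
    intro i
    rw [← sub_nonneg, ← Finset.sum_sub_distrib]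
    simp only [← Finset.sum_sub_distrib, ← mul_sub]
    exact sum_hadamard_nonneg (posSemidef_inner fun α => S.E i (u α)) (hgs i) _
  rw [h1]
  refine (Finset.sum_le_sum fun i _ => h2 i).trans ?_
  rw [pairing_eq_sum g subset_rfl subset_rfl, ← sub_nonneg]
  have h3 := posSemidef_inner_sub_inner (fun α => u α)
    (fun α => WithLp.toLp 2 fun i => S.E i (u α)) (fun x => by
      have : Finsupp.linearCombination ℂ (fun α => WithLp.toLp 2 fun i => S.E i (u α)) x =
          WithLp.toLp 2 fun i => S.E i (Finsupp.linearCombination ℂ (fun α => u α) x) := by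
        ext i
        simp [Finsupp.linearCombination_apply, Finsupp.sum]
      rw [this, ← sq_le_sq₀ (norm_nonneg _) (norm_nonneg _), PiLp.norm_sq_eq_of_L2]
      exact S.sum_norm_sq_le _)
  refine (sum_hadamard_nonneg h3 hg u.support).trans_eq ?_
  rw [Finset.sum_comm (s := Finset.univ), ← Finset.sum_sub_distrib]
  refine Finset.sum_congr rfl fun α _ => ?_
  rw [Finset.sum_comm (s := Finset.univ), ← Finset.sum_sub_distrib]
  refine Finset.sum_congr rfl fun β _ => ?_
  simp [sub_mul, PiLp.inner_apply, Finset.sum_mul]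

theorem support_single_add_subset {ι E F : Type*} [Zero ι] [DecidableEq ι] [AddCommGroup E]
    [Module ℂ E] [AddCommGroup F] [Module ℂ F] (e : F) (A : E →ₗ[ℂ] F) (w : ι →₀ E) :
    (Finsupp.single 0 e + Finsupp.mapRange.linearMap A w).support ⊆ {0} ∪ w.support :=
  Finsupp.support_add.trans (Finset.union_subset_union Finsupp.support_single_subset
    (Finsupp.support_mapRange (hf := A.map_zero)))

theorem single_zero_apply_eq_smul {ι F : Type*} [Zero ι] [AddCommGroup F] [Module ℂ F]
    (e : F) (α : ι) : (Finsupp.single 0 e : ι →₀ F) α = (Finsupp.single 0 1 : ι →₀ ℂ) α • e := by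
  classical
  by_cases h : 0 = α <;> simp [h]

/-- The colligation is applied coefficientwise to the pairs `(τ α, w α)`, where `τ` is the constant
polynomial `1`. Contractivity makes the input Gram kernel minus the output Gram kernel positive
semi-definite, and the Schur product with `g` preserves this. -/
theorem pairing_add_pairing_le (hg : g.PosSemidef) (w : (Fin N → ℕ) →₀ 𝓗) :
    pairing g (Finsupp.single 0 S.a + Finsupp.mapRange.linearMap (S.B : 𝓗 →ₗ[ℂ] ℂ) w)
        (Finsupp.single 0 S.a + Finsupp.mapRange.linearMap (S.B : 𝓗 →ₗ[ℂ] ℂ) w) +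
      pairing g (Finsupp.single 0 S.c + Finsupp.mapRange.linearMap (S.D : 𝓗 →ₗ[ℂ] 𝓗) w)
        (Finsupp.single 0 S.c + Finsupp.mapRange.linearMap (S.D : 𝓗 →ₗ[ℂ] 𝓗) w) ≤
      g 0 0 + pairing g w w := by
  classical
  set s : Finset (Fin N → ℕ) := {0} ∪ w.support with hs
  have hw : w.support ⊆ s := Finset.subset_union_right
  set τ : (Fin N → ℕ) →₀ ℂ := Finsupp.single 0 1
  have hτ : τ.support ⊆ s :=
    Finsupp.support_single_subset.trans Finset.subset_union_left
  have hg0 : g 0 0 = pairing g τ τ := by simp [pairing, τ]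
  have h3 := posSemidef_inner_sub_inner
    (fun α => WithLp.toLp 2 (τ α, w α))
    (fun α => WithLp.toLp 2 (τ α * S.a + S.B (w α), τ α • S.c + S.D (w α))) (fun x => by
      have e1 : Finsupp.linearCombination ℂ (fun α => WithLp.toLp 2 (τ α, w α)) x =
          WithLp.toLp 2 (x.sum fun α t => t • τ α, x.sum fun α t => t • w α) := by
        simp only [Finsupp.linearCombination_apply, Finsupp.sum]
        simp only [← WithLp.toLp_smul, ← WithLp.toLp_sum, Prod.smul_mk]
        rw [WithLp.ext_iff, Prod.ext_iff]
        simp only [Prod.fst_sum, Prod.snd_sum]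
        exact ⟨trivial, trivial⟩
      have e2 : Finsupp.linearCombination ℂ (fun α => WithLp.toLp 2
            (τ α * S.a + S.B (w α), τ α • S.c + S.D (w α))) x =
          WithLp.toLp 2 ((x.sum fun α t => t • τ α) * S.a + S.B (x.sum fun α t => t • w α),
            (x.sum fun α t => t • τ α) • S.c + S.D (x.sum fun α t => t • w α)) := by
        simp only [Finsupp.linearCombination_apply, Finsupp.sum]
        simp only [← WithLp.toLp_smul, ← WithLp.toLp_sum, Prod.smul_mk]
        rw [WithLp.ext_iff, Prod.ext_iff]
        simp only [Prod.fst_sum, Prod.snd_sum]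
        simp [Finset.sum_add_distrib, Finset.sum_mul, Finset.sum_smul, smul_smul, mul_add,
          mul_assoc]
      rw [e1, e2, ← sq_le_sq₀ (norm_nonneg _) (norm_nonneg _), WithLp.prod_norm_sq_eq_of_L2,
        WithLp.prod_norm_sq_eq_of_L2]
      exact S.contractive _ _)
  rw [← sub_nonneg, hg0,
    pairing_eq_sum g (support_single_add_subset _ _ _) (support_single_add_subset _ _ _),
    pairing_eq_sum g (support_single_add_subset _ _ _) (support_single_add_subset _ _ _),
    pairing_eq_sum g hw hw, pairing_eq_sum g hτ hτ]
  rw [← hs]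
  refine (sum_hadamard_nonneg h3 hg s).trans_eq ?_
  simp only [← Finset.sum_add_distrib, ← Finset.sum_sub_distrib]
  refine Finset.sum_congr rfl fun α _ => Finset.sum_congr rfl fun β _ => ?_
  simp only [Matrix.of_apply, WithLp.prod_inner_apply, Finsupp.add_apply,
    single_zero_apply_eq_smul S.a, single_zero_apply_eq_smul S.c, τ,
    Finsupp.mapRange.linearMap_apply, Finsupp.mapRange_apply, smul_eq_mul,
    ContinuousLinearMap.coe_coe]
  ring

/-- At each step the input `1` brings energy `g 0 0` and `partialSum n` is emitted. The energy of
the state telescopes, starting from `0`, and its nonnegative final value is dropped. -/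
theorem sum_pairing_partialSum_le (hg : g.PosSemidef)
    (hgs : ∀ i : Fin N, (g - Matrix.of fun α β =>
      g (α + Pi.single i 1) (β + Pi.single i 1)).PosSemidef) (m : ℕ) :
    ∑ n ∈ Finset.range m, pairing g (S.partialSum n) (S.partialSum n) ≤ m * g 0 0 := by
  have energy : ∀ m, pairing g (S.partialSum m) (S.partialSum m) +
      pairing g (S.state (m + 1)) (S.state (m + 1)) ≤
        g 0 0 + pairing g (S.state m) (S.state m) := fun m =>
    (S.pairing_add_pairing_le hg _).trans (add_le_add_right (S.pairing_shift_le hg hgs _) _)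
  have key : ∀ m, ∑ n ∈ Finset.range m, pairing g (S.partialSum n) (S.partialSum n) +
      pairing g (S.state m) (S.state m) ≤ m * g 0 0 := by
    intro m
    induction m with
    | zero => simp [state, pairing]
    | succ m ih =>
      rw [Finset.sum_range_succ, add_assoc]
      calc _ ≤ _ + (g 0 0 + pairing g (S.state m) (S.state m)) := by
              exact add_le_add_right (energy m) _
        _ = (_ + pairing g (S.state m) (S.state m)) + g 0 0 := by ring
        _ ≤ m * g 0 0 + g 0 0 := by gcongr
        _ = _ := by push_cast; ring
  exact (le_add_of_nonneg_right (pairing_self_nonneg hg _)).trans (key m)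

end Colligation

/-- The energy estimate bounds only averages of the partial sums; Cesàro convergence passes the
bound to the limit. -/
theorem le_of_tendsto_of_sum_le {q : ℕ → ℝ} {L C : ℝ} (hq : Tendsto q atTop (𝓝 L))
    (h : ∀ m : ℕ, ∑ n ∈ Finset.range m, q n ≤ m * C) : L ≤ C := by
  refine le_of_tendsto hq.cesaro ?_
  filter_upwards [eventually_gt_atTop 0] with m hm
  rw [inv_mul_le_iff₀ (by exact_mod_cast hm)]
  exact h m

/-! ### Power series in several commuting operators -/

theorem prod_ofFn_pow_add_single {M : Type*} [Monoid M] {N : ℕ} (T : Fin N → M)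
    (hT : ∀ i j, Commute (T i) (T j)) (α : Fin N → ℕ) (i : Fin N) :
    (List.ofFn fun j => T j ^ (α + Pi.single i 1 : Fin N → ℕ) j).prod =
      T i * (List.ofFn fun j => T j ^ α j).prod := by
  induction N with
  | zero => exact i.elim0
  | succ N ih =>
    rw [List.ofFn_succ, List.ofFn_succ, List.prod_cons, List.prod_cons]
    induction i using Fin.cases with
    | zero => simp [pow_succ', mul_assoc]
    | succ i =>
      have h := ih (fun j => T j.succ) (fun j k => hT _ _) (fun j => α j.succ) i
      have e : (fun j : Fin N => T j.succ ^ (α + Pi.single i.succ 1 : Fin (N + 1) → ℕ) j.succ) =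
          fun j => T j.succ ^ ((fun j => α j.succ) + Pi.single i 1 : Fin N → ℕ) j := by
        funext j
        by_cases hj : j = i
        · subst hj; simp
        · simp [hj]
      rw [e, h]
      simp only [Pi.add_apply, ne_eq, Fin.succ_ne_zero, not_false_eq_true, Pi.single_eq_of_ne',
        add_zero]
      rw [← mul_assoc, ← mul_assoc, ((hT 0 i.succ).pow_left (α 0)).eq]

/-- The assumption on `1` is only an inequality, so that operators on the zero space are covered. -/
theorem norm_prod_ofFn_pow_le {A : Type*} [SeminormedRing A] (h1 : ‖(1 : A)‖ ≤ 1) {N : ℕ}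
    (T : Fin N → A) (α : Fin N → ℕ) :
    ‖(List.ofFn fun j => T j ^ α j).prod‖ ≤ ∏ j, ‖T j‖ ^ α j := by
  have hpow : ∀ (x : A) (n : ℕ), ‖x ^ n‖ ≤ ‖x‖ ^ n := by
    intro x n
    rcases Nat.eq_zero_or_pos n with rfl | hn
    · simpa using h1
    · exact norm_pow_le' x hn
  induction N with
  | zero => simpa using h1
  | succ N ih =>
    rw [List.ofFn_succ, List.prod_cons, Fin.prod_univ_succ]
    exact (norm_mul_le _ _).trans (mul_le_mul (hpow _ _) (ih _ _) (norm_nonneg _) (by positivity))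

theorem summable_prod_pow {N : ℕ} (r : Fin N → ℝ) (h0 : ∀ i, 0 ≤ r i) (h1 : ∀ i, r i < 1) :
    Summable fun α : Fin N → ℕ => ∏ i, r i ^ α i := by
  classical
  refine summable_of_sum_le (c := ∏ i, (1 - r i)⁻¹)
    (fun α => Finset.prod_nonneg fun i _ => pow_nonneg (h0 i) _) fun s => ?_
  obtain ⟨b, hb⟩ := s.bddAbove
  calc ∑ α ∈ s, ∏ i, r i ^ α i
      ≤ ∑ α ∈ Fintype.piFinset fun i => Finset.range (b i + 1), ∏ i, r i ^ α i := by
        refine Finset.sum_le_sum_of_subset_of_nonneg (fun α hα => ?_)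
          (fun α _ _ => Finset.prod_nonneg fun i _ => pow_nonneg (h0 i) _)
        exact Fintype.mem_piFinset.2 fun i => Finset.mem_range.2 (Nat.lt_succ_of_le (hb hα i))
    _ = ∏ i, ∑ n ∈ Finset.range (b i + 1), r i ^ n :=
        (Finset.prod_univ_sum (fun i => Finset.range (b i + 1)) fun i n => r i ^ n).symm
    _ ≤ _ := by
        refine Finset.prod_le_prod (fun i _ => Finset.sum_nonneg fun n _ => pow_nonneg (h0 i) _)
          fun i _ => ?_
        rw [← tsum_geometric_of_lt_one (h0 i) (h1 i)]
        exact (summable_geometric_of_lt_one (h0 i) (h1 i)).sum_le_tsum _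
          fun n _ => pow_nonneg (h0 i) _

/-- Multi-indices of total degree at most `n`. -/
def degreeLE (N n : ℕ) : Finset (Fin N → ℕ) :=
  (Fintype.piFinset fun _ => Finset.range (n + 1)).filter fun α => ∑ i, α i ≤ n

theorem mem_degreeLE {N n : ℕ} {α : Fin N → ℕ} : α ∈ degreeLE N n ↔ ∑ i, α i ≤ n := by
  simp only [degreeLE, Finset.mem_filter, Fintype.mem_piFinset, Finset.mem_range,
    Nat.lt_succ_iff, and_iff_right_iff_imp]
  exact fun h i => (Finset.single_le_sum (fun _ _ => Nat.zero_le _) (Finset.mem_univ i)).trans h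

theorem tendsto_degreeLE (N : ℕ) : Tendsto (degreeLE N) atTop atTop :=
  tendsto_atTop_finset_of_monotone
    (fun _ _ h _ hα => mem_degreeLE.2 ((mem_degreeLE.1 hα).trans h))
    fun α => ⟨∑ i, α i, mem_degreeLE.2 le_rfl⟩

/-! ### Transfer functions belong to the Agler class -/

namespace Colligation

variable {N : ℕ} {𝓗 : Type*} [NormedAddCommGroup 𝓗] [InnerProductSpace ℂ 𝓗]
  (S : Colligation N 𝓗)

theorem support_partialSum_subset (n : ℕ) : (S.partialSum n).support ⊆ degreeLE N n := by
  intro α hα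
  rw [mem_degreeLE]
  by_contra h
  exact Finsupp.mem_support_iff.1 hα (S.partialSum_apply_of_lt (not_le.1 h))

theorem sum_partialSum {X : Type*} [AddCommGroup X] [Module ℂ X] (x : (Fin N → ℕ) → X) (n : ℕ) :
    (S.partialSum n).sum (fun α t => t • x α) = ∑ α ∈ degreeLE N n, S.coeff α • x α := by
  rw [Finsupp.sum_of_support_subset _ (S.support_partialSum_subset n) _ (by simp)]
  exact Finset.sum_congr rfl fun α hα => by rw [S.partialSum_apply_of_le (mem_degreeLE.1 hα)]

theorem sum_norm_sq_partialSum_le {X : Type*} [NormedAddCommGroup X] [InnerProductSpace ℂ X]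
    (x : (Fin N → ℕ) → X) (hx : ∀ i : Fin N, (Matrix.of fun α β => inner ℂ (x α) (x β) -
      inner ℂ (x (α + Pi.single i 1)) (x (β + Pi.single i 1))).PosSemidef) (m : ℕ) :
    ∑ n ∈ Finset.range m, ‖∑ α ∈ degreeLE N n, S.coeff α • x α‖ ^ 2 ≤ m * ‖x 0‖ ^ 2 := by
  have := S.sum_pairing_partialSum_le (posSemidef_inner x) hx m
  simp only [pairing_inner, sum_partialSum, Matrix.of_apply] at this
  rw [inner_self_eq_norm_sq_to_K, ← RCLike.ofReal_pow] at this
  change _ ≤ (m : ℂ) * ((‖x 0‖ ^ 2 : ℝ) : ℂ) at this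
  exact_mod_cast this

/-- For the identity kernel `g = 1` the monomials are orthonormal and the shifts isometric. The
self-pairing is then the sum of the squared coefficients, so the energy estimate controls each of
them. -/
theorem norm_coeff_le_one (α : Fin N → ℕ) : ‖S.coeff α‖ ≤ 1 := by
  classical
  have h := S.sum_pairing_partialSum_le (g := 1) Matrix.PosSemidef.one (fun i => by
    have : (1 : Matrix (Fin N → ℕ) (Fin N → ℕ) ℂ) - Matrix.of (fun α β =>
        (1 : Matrix (Fin N → ℕ) (Fin N → ℕ) ℂ) (α + Pi.single i 1) (β + Pi.single i 1)) = 0 := by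
      ext α β
      simp [Matrix.one_apply]
    rw [this]
    exact Matrix.PosSemidef.zero)
  have e : ∀ n, pairing (1 : Matrix (Fin N → ℕ) (Fin N → ℕ) ℂ) (S.partialSum n) (S.partialSum n) =
      ((∑ β ∈ (S.partialSum n).support, ‖S.partialSum n β‖ ^ 2 : ℝ) : ℂ) := by
    intro n
    rw [pairing_eq_sum _ subset_rfl subset_rfl, Complex.ofReal_sum]
    refine Finset.sum_congr rfl fun β hβ => ?_
    rw [Finset.sum_eq_single β (fun γ _ hγ => by simp [hγ.symm])
      (fun h => absurd hβ h)]
    rw [Matrix.one_apply_eq, mul_one, inner_self_eq_norm_sq_to_K, Complex.ofReal_pow]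
    rfl
  simp only [e, Matrix.one_apply_eq] at h
  have h' : ∀ m : ℕ, ∑ n ∈ Finset.range m, ∑ β ∈ (S.partialSum n).support,
      ‖S.partialSum n β‖ ^ 2 ≤ m * (1 : ℝ) := fun m => by exact_mod_cast h m
  have hlim : Tendsto (fun n => ‖S.partialSum n α‖ ^ 2) atTop (𝓝 (‖S.coeff α‖ ^ 2)) := by
    refine tendsto_const_nhds.congr' ?_
    filter_upwards [eventually_ge_atTop (∑ i, α i)] with n hn
    rw [S.partialSum_apply_of_le hn]
  have := le_of_tendsto_of_sum_le hlim fun m => (Finset.sum_le_sum fun n _ => ?_).trans (h' m)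
  · simpa using this
  · by_cases hα : α ∈ (S.partialSum n).support
    · exact Finset.single_le_sum (f := fun β => ‖S.partialSum n β‖ ^ 2)
        (fun _ _ => by positivity) hα
    · rw [Finsupp.notMem_support_iff.1 hα]
      simpa using Finset.sum_nonneg fun _ _ => by positivity

theorem norm_D_le : ‖S.D‖ ≤ 1 := by
  refine S.D.opNorm_le_bound zero_le_one fun h => ?_
  have := S.contractive 0 h
  simp only [zero_mul, zero_add, zero_smul, norm_zero] at this
  rw [one_mul]
  exact abs_le_of_sq_le_sq' (by nlinarith [sq_nonneg ‖S.B h‖]) (norm_nonneg _) |>.2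

/-- The operator `∑ z_i E_i`. -/
def diag (z : Fin N → ℂ) : 𝓗 →L[ℂ] 𝓗 := ∑ i, z i • S.E i

theorem norm_diag_le (z : Fin N → ℂ) : ‖S.diag z‖ ≤ ‖z‖ := by
  refine ContinuousLinearMap.opNorm_le_bound _ (norm_nonneg _) fun h => ?_
  have e : ‖S.diag z h‖ ^ 2 = ∑ i, ‖z i‖ ^ 2 * ‖S.E i h‖ ^ 2 := by
    have : ((‖S.diag z h‖ ^ 2 : ℝ) : ℂ) = ((∑ i, ‖z i‖ ^ 2 * ‖S.E i h‖ ^ 2 : ℝ) : ℂ) := by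
      have h1 := inner_self_eq_norm_sq_to_K (𝕜 := ℂ) (S.diag z h)
      rw [Complex.ofReal_pow]
      refine h1.symm.trans ?_
      simp only [diag, sum_apply, smul_apply, sum_inner,
        inner_sum, inner_smul_left, inner_smul_right, Complex.ofReal_sum]
      refine Finset.sum_congr rfl fun i _ => ?_
      rw [Finset.sum_eq_single i (fun j _ hj => by simp [S.orthogonal j i hj]) (by simp),
        inner_self_eq_norm_sq_to_K, ← mul_assoc, Complex.mul_conj']
      push_cast
      rfl
    exact_mod_cast this
  refine abs_le_of_sq_le_sq' ?_ (by positivity) |>.2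
  rw [e, mul_pow]
  calc _ ≤ ∑ i, ‖z‖ ^ 2 * ‖S.E i h‖ ^ 2 := by
        gcongr with i
        exact norm_le_pi_norm z i
    _ ≤ _ := by
        rw [← Finset.mul_sum]
        gcongr
        exact S.sum_norm_sq_le h

variable {z : Fin N → ℂ}

/-- Evaluation of an `𝓗`-valued polynomial at a point. -/
def evalAt (𝓗 : Type*) [NormedAddCommGroup 𝓗] [InnerProductSpace ℂ 𝓗] (z : Fin N → ℂ) :
    ((Fin N → ℕ) →₀ 𝓗) →ₗ[ℂ] 𝓗 :=
  Finsupp.lsum ℂ fun α => (∏ i, z i ^ α i) • LinearMap.id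

theorem evalAt_mapRange {F : Type*} [NormedAddCommGroup F] [InnerProductSpace ℂ F]
    (A : 𝓗 →ₗ[ℂ] F) (u : (Fin N → ℕ) →₀ 𝓗) :
    evalAt F z (Finsupp.mapRange.linearMap A u) = A (evalAt 𝓗 z u) := by
  simp only [evalAt, Finsupp.lsum_apply, Finsupp.mapRange.linearMap_apply]
  rw [Finsupp.sum_mapRange_index (by simp)]
  simp [Finsupp.sum, map_sum]

theorem evalAt_shift (u : (Fin N → ℕ) →₀ 𝓗) :
    evalAt 𝓗 z (S.shift u) = S.diag z (evalAt 𝓗 z u) := by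
  rw [shift_apply, map_sum, diag, sum_apply]
  refine Finset.sum_congr rfl fun i _ => ?_
  rw [smul_apply]
  refine Eq.trans ?_ (congrArg (z i • ·) (evalAt_mapRange (z := z) (S.E i : 𝓗 →ₗ[ℂ] 𝓗) u))
  simp only [evalAt, Finsupp.lsum_apply]
  rw [Finsupp.sum_mapDomain_index (by simp) (by simp), Finsupp.smul_sum]
  refine Finsupp.sum_congr fun α _ => ?_
  have : ∏ j, z j ^ (Pi.single i 1 : Fin N → ℕ) j = z i := by
    rw [Finset.prod_eq_single i (fun j _ hj => by simp [hj]) (by simp)]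
    simp
  simp [pow_add, Finset.prod_mul_distrib, smul_smul, this, mul_comm (z i)]


theorem evalAt_single_zero (h : 𝓗) : evalAt 𝓗 z (Finsupp.single 0 h) = h := by
  simp [evalAt]

theorem summable_norm_coeff_smul {X : Type*} [NormedAddCommGroup X] [NormedSpace ℂ X]
    (x : (Fin N → ℕ) → X) (r : Fin N → ℝ) (h0 : ∀ i, 0 ≤ r i) (h1 : ∀ i, r i < 1)
    (hx : ∀ α, ‖x α‖ ≤ ∏ i, r i ^ α i) : Summable fun α => ‖S.coeff α • x α‖ := by
  refine Summable.of_nonneg_of_le (fun _ => norm_nonneg _) (fun α => ?_) (summable_prod_pow r h0 h1)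
  rw [norm_smul]
  exact (mul_le_of_le_one_left (norm_nonneg _) (S.norm_coeff_le_one α)).trans (hx α)

variable [CompleteSpace 𝓗]

/-- The transfer function `a + B Z(z) (1 - D Z(z))⁻¹ c`, where `Z(z) = ∑ z_i E_i`. -/
def transfer (z : Fin N → ℂ) : ℂ :=
  S.a + S.B (S.diag z (Ring.inverse (1 - S.D * S.diag z) S.c))

theorem norm_D_mul_diag_lt_one (hz : ‖z‖ < 1) : ‖S.D * S.diag z‖ < 1 :=
  calc _ ≤ ‖S.D‖ * ‖S.diag z‖ := norm_mul_le _ _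
    _ ≤ 1 * ‖z‖ := mul_le_mul S.norm_D_le (S.norm_diag_le z) (norm_nonneg _) zero_le_one
    _ < 1 := by rwa [one_mul]

theorem inverse_apply (hz : ‖z‖ < 1) :
    Ring.inverse (1 - S.D * S.diag z) S.c =
      S.c + S.D (S.diag z (Ring.inverse (1 - S.D * S.diag z) S.c)) := by
  have := Ring.mul_inverse_cancel _ (isUnit_one_sub_of_norm_lt_one (S.norm_D_mul_diag_lt_one hz))
  have h := congrArg (fun A : 𝓗 →L[ℂ] 𝓗 => A S.c) this
  rw [sub_mul, one_mul] at h
  exact sub_eq_iff_eq_add.1 h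

/-- For `k = (1 - D Z)⁻¹ c` the colligation sends `(1, Z k)` to `(transfer z, k)`, and `‖Z k‖ ≤
‖k‖`. -/
theorem norm_transfer_le (hz : ‖z‖ < 1) : ‖S.transfer z‖ ≤ 1 := by
  set k := Ring.inverse (1 - S.D * S.diag z) S.c with hk
  have h := S.contractive 1 (S.diag z k)
  rw [one_mul, one_smul, ← S.inverse_apply hz, ← hk, norm_one] at h
  have h2 : ‖S.diag z k‖ ≤ ‖k‖ :=
    ((S.diag z).le_opNorm k).trans (mul_le_of_le_one_left (norm_nonneg _)
      ((S.norm_diag_le z).trans hz.le))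
  have h3 : ‖S.transfer z‖ ^ 2 ≤ 1 := by
    have : ‖S.diag z k‖ ^ 2 ≤ ‖k‖ ^ 2 := pow_le_pow_left₀ (norm_nonneg _) h2 2
    change ‖S.a + S.B (S.diag z k)‖ ^ 2 ≤ 1
    linarith
  exact (sq_le_one_iff₀ (norm_nonneg _)).1 h3

theorem analyticAt_transfer (hz : ‖z‖ < 1) : AnalyticAt ℂ S.transfer z := by
  have h1 : AnalyticAt ℂ S.diag z := by
    have : S.diag = fun z => (∑ i, (ContinuousLinearMap.proj (R := ℂ)
        (φ := fun _ : Fin N => ℂ) i).smulRight (S.E i)) z := by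
      funext z; simp [diag]
    rw [this]
    exact ContinuousLinearMap.analyticAt _ z
  obtain ⟨u, hu⟩ := isUnit_one_sub_of_norm_lt_one (S.norm_D_mul_diag_lt_one hz)
  have h2 : AnalyticAt ℂ (fun z => Ring.inverse (1 - S.D * S.diag z)) z := by
    have h3 := analyticAt_inverse (𝕜 := ℂ) u
    rw [hu] at h3
    exact h3.comp_of_eq (analyticAt_const.sub (analyticAt_const.mul h1)) rfl
  have h4 : AnalyticAt ℂ (fun z => S.diag z * Ring.inverse (1 - S.D * S.diag z)) z := h1.mul h2
  exact analyticAt_const.add ((ContinuousLinearMap.analyticAt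
    (S.B ∘L ContinuousLinearMap.apply ℂ 𝓗 S.c) _).comp h4)

theorem tendsto_evalAt_partialSum (hz : ‖z‖ < 1) :
    Tendsto (fun n => evalAt ℂ z (S.partialSum n)) atTop (𝓝 (S.transfer z)) := by
  set k := Ring.inverse (1 - S.D * S.diag z) S.c with hk
  -- The evaluated recursion is the fixed-point iteration for `k = c + D Z k`, started at `0`.
  have h1 : ∀ n, evalAt 𝓗 z (S.state n) - k = ((S.D * S.diag z) ^ n) (-k) := by
    intro n
    induction n with
    | zero => simp [state]
    | succ n ih =>
      rw [state, map_add, evalAt_single_zero, evalAt_mapRange, evalAt_shift, pow_succ',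
        ContinuousLinearMap.mul_def, ContinuousLinearMap.comp_apply, ← ih]
      nth_rewrite 1 [hk]
      rw [S.inverse_apply hz, ← hk]
      simp [map_sub]
  have h2 : Tendsto (fun n => ((S.D * S.diag z) ^ n) (-k)) atTop (𝓝 0) := by
    have h := tendsto_pow_atTop_nhds_zero_of_norm_lt_one (S.norm_D_mul_diag_lt_one hz)
    have h' := ((ContinuousLinearMap.apply ℂ 𝓗 (-k)).continuous.tendsto 0).comp h
    rwa [map_zero] at h'
  have h3 : Tendsto (fun n => evalAt 𝓗 z (S.state n)) atTop (𝓝 k) := by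
    simpa [← h1] using h2.add_const k
  have h4 : ∀ n, evalAt ℂ z (S.partialSum n) = S.a + S.B (S.diag z (evalAt 𝓗 z (S.state n))) := by
    intro n
    rw [partialSum, map_add, evalAt_single_zero, evalAt_mapRange, evalAt_shift]
    rfl
  simp only [h4]
  exact ((S.B ∘L S.diag z).continuous.tendsto k |>.comp h3).const_add S.a

theorem hasPolydiskSeries_transfer : HasPolydiskSeries S.transfer S.coeff := by
  intro z hz
  have hz' : ‖z‖ < 1 := by simpa using hz
  have hs : Summable fun α => S.coeff α • ∏ i, z i ^ α i := by
    refine Summable.of_norm (S.summable_norm_coeff_smul (fun α => ∏ i, z i ^ α i)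
      (fun i => ‖z i‖) (fun i => norm_nonneg _)
      (fun i => (norm_le_pi_norm z i).trans_lt hz') fun α => ?_)
    rw [norm_prod]
    exact (Finset.prod_congr rfl fun i _ => norm_pow _ _).le
  have h1 := hs.hasSum.comp (tendsto_degreeLE N)
  have h2 : (fun n => evalAt ℂ z (S.partialSum n)) =
      (fun s => ∑ α ∈ s, S.coeff α • ∏ i, z i ^ α i) ∘ degreeLE N := by
    funext n
    rw [Function.comp_apply, ← S.sum_partialSum]
    simp only [evalAt, Finsupp.lsum_apply]
    exact Finsupp.sum_congr fun α _ => mul_comm _ _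
  rw [← h2] at h1
  rw [tendsto_nhds_unique (S.tendsto_evalAt_partialSum hz') h1]
  simpa only [smul_eq_mul] using hs.hasSum

theorem memAgler_transfer : MemAgler N S.transfer where
  analytic z hz := S.analyticAt_transfer (by simpa using hz)
  bounded z hz := S.norm_transfer_le (by simpa using hz)
  vonNeumann := by
    refine ⟨S.coeff, S.hasPolydiskSeries_transfer, fun H _ _ _ T hT hc => ?_⟩
    have hs : Summable fun α => ‖S.coeff α • opMonomial T α‖ :=
      S.summable_norm_coeff_smul _ (fun i => ‖T i‖) (fun i => norm_nonneg _) hT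
        (norm_prod_ofFn_pow_le ContinuousLinearMap.norm_id_le T)
    refine ⟨hs, ContinuousLinearMap.opNorm_le_bound _ zero_le_one fun x => ?_⟩
    have hl : Tendsto (fun n => ∑ α ∈ degreeLE N n, S.coeff α • opMonomial T α x) atTop
        (𝓝 ((∑' α, S.coeff α • opMonomial T α) x)) := by
      have h1 := hs.of_norm.hasSum.comp (tendsto_degreeLE N)
      have h2 := ((ContinuousLinearMap.apply ℂ H x).continuous.tendsto _).comp h1
      refine h2.congr fun n => ?_
      simp
    -- The energy estimate for the Gram kernel of the vectors `T^α x`: raising `α` by one in place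
    -- `i` applies the contraction `T i`.
    have h3 := le_of_tendsto_of_sum_le (hl.norm.pow 2)
      (S.sum_norm_sq_partialSum_le (fun α => opMonomial T α x) fun i => by
        have e : ∀ α, opMonomial T (α + Pi.single i 1) x = T i (opMonomial T α x) := fun α => by
          rw [opMonomial, prod_ofFn_pow_add_single T hc]; rfl
        simp only [e]
        refine posSemidef_inner_sub_inner _ _ fun y => ?_
        have : Finsupp.linearCombination ℂ (fun α => T i (opMonomial T α x)) y =
            T i (Finsupp.linearCombination ℂ (fun α => opMonomial T α x) y) := by
          simp [Finsupp.linearCombination_apply, Finsupp.sum]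
        rw [this]
        exact ((T i).le_opNorm _).trans (mul_le_of_le_one_left (norm_nonneg _) (hT i).le))
    rw [one_mul]
    refine abs_le_of_sq_le_sq' (h3.trans_eq ?_) (norm_nonneg _) |>.2
    have : opMonomial T (0 : Fin N → ℕ) = 1 := by
      simp [opMonomial]
    rw [this]
    simp

end Colligation

open scoped ZeroAtInfty

/-! ### Prime powers -/

theorem two_le_prm (j : ℕ) : 2 ≤ prm j := (Nat.prime_nth_prime j).two_le

theorem norm_prm_cpow (j : ℕ) (s : ℂ) : ‖(prm j : ℂ) ^ (-s)‖ = (prm j : ℝ) ^ (-s.re) := by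
  rw [Complex.norm_natCast_cpow_of_pos (by have := two_le_prm j; lia), Complex.neg_re]

theorem norm_prm_cpow_le {s : ℂ} (hs : 0 < s.re) (j : ℕ) :
    ‖(prm j : ℂ) ^ (-s)‖ ≤ (2 : ℝ) ^ (-s.re) := by
  rw [norm_prm_cpow]
  exact Real.rpow_le_rpow_of_nonpos two_pos (by exact_mod_cast two_le_prm j) (by linarith)

theorem two_rpow_neg_lt_one {x : ℝ} (hx : 0 < x) : (2 : ℝ) ^ (-x) < 1 :=
  Real.rpow_lt_one_of_one_lt_of_neg one_lt_two (by linarith)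

theorem norm_prm_cpow_lt_one {s : ℂ} (hs : 0 < s.re) (j : ℕ) : ‖(prm j : ℂ) ^ (-s)‖ < 1 :=
  (norm_prm_cpow_le hs j).trans_lt (two_rpow_neg_lt_one hs)

theorem prm_cpow_neg_add_conj (j : ℕ) (s w : ℂ) :
    (prm j : ℂ) ^ (-(s + conj w)) = (prm j : ℂ) ^ (-s) * conj ((prm j : ℂ) ^ (-w)) := by
  have h0 : (prm j : ℂ) ≠ 0 := by have := two_le_prm j; exact_mod_cast (by lia : prm j ≠ 0)
  rw [neg_add, Complex.cpow_add _ _ h0, ← map_neg, Complex.cpow_conj, Complex.conj_natCast]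
  rw [Complex.natCast_arg]
  exact Real.pi_pos.ne

/-! ### Elements of `c₀` -/

theorem norm_apply_le_norm (z : C₀(ℕ, ℂ)) (j : ℕ) : ‖z j‖ ≤ ‖z‖ := by
  rw [← ZeroAtInftyContinuousMap.norm_toBCF_eq_norm]
  exact z.toBCF.norm_coe_le_norm j

theorem norm_le_of_apply_le {z : C₀(ℕ, ℂ)} {r : ℝ} (hr : 0 ≤ r) (h : ∀ j, ‖z j‖ ≤ r) : ‖z‖ ≤ r := by
  rw [← ZeroAtInftyContinuousMap.norm_toBCF_eq_norm]
  exact (BoundedContinuousFunction.norm_le hr).2 h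

theorem norm_primePoint_lt_one (s : ℂ) (hs : s ∈ rightHalfPlane) : ‖primePoint s hs‖ < 1 :=
  (norm_le_of_apply_le (by positivity) fun j => norm_prm_cpow_le hs j).trans_lt
    (two_rpow_neg_lt_one hs)

/-- The point `(z₁, …, z_N, 0, 0, …)` as an element of `c₀`. -/
def padC0 {N : ℕ} (z : Fin N → ℂ) : C₀(ℕ, ℂ) where
  toFun := padZero z
  continuous_toFun := continuous_of_discreteTopology
  zero_at_infty' := by
    rw [Filter.cocompact_eq_cofinite, Nat.cofinite_eq_atTop]
    refine tendsto_const_nhds.congr' ?_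
    filter_upwards [eventually_ge_atTop N] with j hj
    simp [padZero, not_lt.2 hj]

theorem padC0_apply {N : ℕ} (z : Fin N → ℂ) (j : ℕ) : padC0 z j = padZero z j := rfl

theorem finite_support_padC0 {N : ℕ} (z : Fin N → ℂ) : (Function.support (padC0 z)).Finite := by
  refine (Set.finite_lt_nat N).subset fun j hj => ?_
  by_contra h
  exact hj (by simp only [padC0_apply, padZero]; exact dif_neg h)

/-! ### Contractions from isometric families -/

/-- If `⟪x s, x t⟫ = ⟪y s, y t⟫` for all `s, t`, then some contraction maps every `x s` to `y s`. -/
theorem exists_contraction {X E F : Type*} [NormedAddCommGroup E] [InnerProductSpace ℂ E]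
    [CompleteSpace E] [NormedAddCommGroup F] [InnerProductSpace ℂ F] [CompleteSpace F]
    (x : X → E) (y : X → F) (h : ∀ s t, inner ℂ (x s) (x t) = inner ℂ (y s) (y t)) :
    ∃ V : E →L[ℂ] F, (∀ s, V (x s) = y s) ∧ ∀ e, ‖V e‖ ≤ ‖e‖ := by
  have hn : ∀ a : X →₀ ℂ, ‖Finsupp.linearCombination ℂ y a‖ =
      ‖Finsupp.linearCombination ℂ x a‖ := fun a => by
    have e1 := sum_star_inner_mul a x
    have e2 := sum_star_inner_mul a y
    simp only [h] at e1
    have := e1.symm.trans e2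
    exact ((sq_eq_sq₀ (norm_nonneg _) (norm_nonneg _)).1 (by exact_mod_cast this)).symm
  set lx := Finsupp.linearCombination ℂ x
  set ly := Finsupp.linearCombination ℂ y
  set K : Submodule ℂ E := (LinearMap.range lx).topologicalClosure
  have hK : ∀ a, lx a ∈ K := fun a => Submodule.le_topologicalClosure _ ⟨a, rfl⟩
  set e : (X →₀ ℂ) →ₗ[ℂ] K := lx.codRestrict K hK
  have hd : DenseRange e := by
    rw [DenseRange, dense_iff_closure_eq, Set.eq_univ_iff_forall]
    intro k
    rw [closure_subtype]
    have : ((↑) '' Set.range e : Set E) = (LinearMap.range lx : Set E) := by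
      ext v
      simp only [Set.mem_image, Set.mem_range, exists_exists_eq_and]
      rfl
    rw [this, ← Submodule.topologicalClosure_coe]
    exact k.2
  have hb : ∀ a, ‖ly a‖ ≤ 1 * ‖e a‖ := fun a => by
    rw [one_mul, hn a]; rfl
  have : CompleteSpace K := (Submodule.isClosed_topologicalClosure _).completeSpace_coe
  -- The isometry on the span extends by continuity to the closure `K` and by zero to the orthogonal
  -- complement.
  refine ⟨ly.extendOfNorm e ∘L K.orthogonalProjectionOnto, fun s => ?_, fun v => ?_⟩
  · have hs : lx (Finsupp.single s 1) = x s := by simp [lx]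
    have h1 : K.orthogonalProjectionOnto (x s) = e (Finsupp.single s 1) := by
      have := Submodule.orthogonalProjectionOnto_mem_subspace_eq_self (e (Finsupp.single s 1))
      rwa [show ((e (Finsupp.single s 1) : K) : E) = x s from hs] at this
    rw [ContinuousLinearMap.comp_apply, h1, LinearMap.extendOfNorm_eq hd ⟨1, hb⟩]
    simp [ly]
  · refine (LinearMap.norm_extendOfNorm_apply_le hd 1 hb _).trans ?_
    rw [one_mul]
    exact (K.orthogonalProjectionOnto.le_opNorm v).trans
      (mul_le_of_le_one_left (norm_nonneg _) K.orthogonalProjectionOnto_norm_le)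

/-! ### Diagonal operators on Hilbert sums -/

section HilbertSum

theorem memℓp_two_iff {H : ℕ → Type*} [∀ j, NormedAddCommGroup (H j)] {h : ∀ j, H j} :
    Memℓp h 2 ↔ Summable fun j => ‖h j‖ ^ 2 := by
  rw [memℓp_gen_iff (by simp)]
  simp

variable {H : ℕ → Type*} [∀ j, NormedAddCommGroup (H j)] [∀ j, InnerProductSpace ℂ (H j)]

theorem hasSum_norm_sq (h : lp H 2) : HasSum (fun j => ‖h j‖ ^ 2) (‖h‖ ^ 2) := by
  have := (lp.hasSum_inner (𝕜 := ℂ) h h).mapL Complex.reCLM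
  simpa only [Complex.reCLM_apply, ← RCLike.re_eq_complex_re, inner_self_eq_norm_sq] using this

theorem norm_smul_apply_sq_le (z : C₀(ℕ, ℂ)) (h : lp H 2) (j : ℕ) :
    ‖z j • h j‖ ^ 2 ≤ ‖z‖ ^ 2 * ‖h j‖ ^ 2 := by
  rw [norm_smul, mul_pow]
  gcongr
  exact norm_apply_le_norm z j

/-- The vector `(z_j h_j)`. -/
def diagonalVec (z : C₀(ℕ, ℂ)) (h : lp H 2) : lp H 2 :=
  ⟨fun j => z j • h j, memℓp_two_iff.2 (Summable.of_nonneg_of_le (fun j => by positivity)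
    (norm_smul_apply_sq_le z h) ((hasSum_norm_sq h).summable.mul_left _))⟩

theorem diagonalVec_apply (z : C₀(ℕ, ℂ)) (h : lp H 2) (j : ℕ) :
    diagonalVec z h j = z j • h j := rfl

theorem norm_diagonalVec_le (z : C₀(ℕ, ℂ)) (h : lp H 2) : ‖diagonalVec z h‖ ≤ ‖z‖ * ‖h‖ := by
  refine abs_le_of_sq_le_sq' ?_ (by positivity) |>.2
  rw [mul_pow]
  exact hasSum_le (norm_smul_apply_sq_le z h) (hasSum_norm_sq (diagonalVec z h))
    ((hasSum_norm_sq h).mul_left _)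

/-- The diagonal operator `(h_j) ↦ (z_j h_j)`. -/
def diagonalOp (H : ℕ → Type*) [∀ j, NormedAddCommGroup (H j)] [∀ j, InnerProductSpace ℂ (H j)] :
    C₀(ℕ, ℂ) →L[ℂ] lp H 2 →L[ℂ] lp H 2 :=
  LinearMap.mkContinuous₂
    (LinearMap.mk₂ ℂ diagonalVec
      (fun z z' h => lp.ext (funext fun j => by
        simp only [diagonalVec_apply, lp.coeFn_add, Pi.add_apply,
          ZeroAtInftyContinuousMap.add_apply, add_smul]))
      (fun t z h => lp.ext (funext fun j => by
        simp only [diagonalVec_apply, lp.coeFn_smul, Pi.smul_apply,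
          ZeroAtInftyContinuousMap.smul_apply, smul_assoc]))
      (fun z h h' => lp.ext (funext fun j => by
        simp only [diagonalVec_apply, lp.coeFn_add, Pi.add_apply, smul_add]))
      (fun t z h => lp.ext (funext fun j => by
        simp only [diagonalVec_apply, lp.coeFn_smul, Pi.smul_apply, smul_comm t]))) 1 fun z h => by
    rw [one_mul]
    exact norm_diagonalVec_le z h

theorem diagonalOp_apply (z : C₀(ℕ, ℂ)) (h : lp H 2) (j : ℕ) :
    diagonalOp H z h j = z j • h j := rfl

theorem norm_diagonalOp_le (z : C₀(ℕ, ℂ)) : ‖diagonalOp H z‖ ≤ ‖z‖ :=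
  ContinuousLinearMap.opNorm_le_bound _ (norm_nonneg _) (norm_diagonalVec_le z)

/-- The colligation given by a contraction of `ℂ ⊕ ⨁ H_j` and the projections onto `H₁, …, H_N`. -/
def Colligation.ofContraction (V : WithLp 2 (ℂ × lp H 2) →L[ℂ] WithLp 2 (ℂ × lp H 2))
    (hV : ∀ e, ‖V e‖ ≤ ‖e‖) (N : ℕ) : Colligation N (lp H 2) where
  a := (V (WithLp.toLp 2 (1, 0))).fst
  c := (V (WithLp.toLp 2 (1, 0))).snd
  B := WithLp.fstL 2 ℂ ℂ (lp H 2) ∘L V ∘L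
    (WithLp.prodContinuousLinearEquiv 2 ℂ ℂ (lp H 2)).symm ∘L ContinuousLinearMap.inr ℂ ℂ (lp H 2)
  D := WithLp.sndL 2 ℂ ℂ (lp H 2) ∘L V ∘L
    (WithLp.prodContinuousLinearEquiv 2 ℂ ℂ (lp H 2)).symm ∘L ContinuousLinearMap.inr ℂ ℂ (lp H 2)
  E i := diagonalOp H (padC0 (Pi.single i 1))
  contractive t h := by
    have e : V (WithLp.toLp 2 (t, h)) =
        t • V (WithLp.toLp 2 (1, 0)) + V (WithLp.toLp 2 (0, h)) := by
      rw [← map_smul, ← map_add, ← WithLp.toLp_smul, ← WithLp.toLp_add]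
      simp
    have := pow_le_pow_left₀ (norm_nonneg _) (hV (WithLp.toLp 2 (t, h))) 2
    rw [WithLp.prod_norm_sq_eq_of_L2, WithLp.prod_norm_sq_eq_of_L2, e] at this
    exact this
  orthogonal i j hij h k := by
    rw [lp.inner_eq_tsum]
    refine (tsum_congr fun l => ?_).trans tsum_zero
    rw [diagonalOp_apply, diagonalOp_apply, padC0_apply, padC0_apply]
    by_cases hl : l < N
    · by_cases hi : (⟨l, hl⟩ : Fin N) = i
      · have hj : (⟨l, hl⟩ : Fin N) ≠ j := fun hj => hij (hi.symm.trans hj)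
        simp [padZero, hl, hj]
      · simp [padZero, hl, hi]
    · simp [padZero, hl]
  sum_norm_sq_le h := by
    have e : ∀ i : Fin N, ‖diagonalOp H (padC0 (Pi.single i 1)) h‖ ^ 2 = ‖h i‖ ^ 2 := fun i => by
      refine (hasSum_norm_sq _).unique ?_
      have : ‖h i‖ ^ 2 = ‖diagonalOp H (padC0 (Pi.single i 1)) h i‖ ^ 2 := by
        simp [diagonalOp_apply, padC0_apply, padZero]
      rw [this]
      refine hasSum_single (i : ℕ) fun l hl => ?_
      rw [diagonalOp_apply, padC0_apply]
      by_cases hlN : l < N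
      · have : (⟨l, hlN⟩ : Fin N) ≠ i := fun h => hl (by rw [← h])
        simp [padZero, hlN, this]
      · simp [padZero, hlN]
    simp only [e]
    rw [Fin.sum_univ_eq_sum_range (fun j => ‖h j‖ ^ 2)]
    exact sum_le_hasSum _ (fun _ _ => by positivity) (hasSum_norm_sq h)

theorem diagonalOp_padC0 (V : WithLp 2 (ℂ × lp H 2) →L[ℂ] WithLp 2 (ℂ × lp H 2))
    (hV : ∀ e, ‖V e‖ ≤ ‖e‖) {N : ℕ} (z : Fin N → ℂ) :
    diagonalOp H (padC0 z) = (Colligation.ofContraction V hV N).diag z := by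
  have : padC0 z = ∑ i, z i • padC0 (Pi.single i 1) := by
    ext j
    have hsum : ∀ g : Fin N → C₀(ℕ, ℂ), (∑ i, g i) j = ∑ i, g i j := fun g =>
      map_sum (⟨⟨fun g : C₀(ℕ, ℂ) => g j, rfl⟩, fun _ _ => rfl⟩ : C₀(ℕ, ℂ) →+ ℂ) g _
    rw [hsum]
    simp only [ZeroAtInftyContinuousMap.smul_apply, padC0_apply, padZero]
    by_cases hj : j < N
    · simp [hj, Pi.single_apply]
    · simp [hj]
  rw [this, map_sum]
  simp only [map_smul]
  rfl

/-- A function with an Agler decomposition, whose kernels are given as Gram kernels, belongs to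
the Bohr image of the Agler class. -/
theorem memBohrAgler_of_gram [∀ j, CompleteSpace (H j)] {f : ℂ → ℂ}
    (k : rightHalfPlane → ∀ j, H j) (hk : ∀ s, Summable fun j => ‖k s j‖ ^ 2)
    (hf : ∀ s w : rightHalfPlane, HasSum
      (fun j => (1 - (prm j : ℂ) ^ (-(w + conj (s : ℂ)))) * inner ℂ (k s j) (k w j))
      (1 - f w * conj (f s))) : MemBohrAgler f := by
  set κ : rightHalfPlane → lp H 2 := fun s => ⟨k s, memℓp_two_iff.2 (hk s)⟩ with hκ
  set Z : C₀(ℕ, ℂ) →L[ℂ] lp H 2 →L[ℂ] lp H 2 := diagonalOp H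
  -- Lurking isometry: equality of the two Gram kernels is the decomposition with its negative terms
  -- moved to the other side.
  obtain ⟨V, hVx, hV⟩ := exists_contraction
    (fun s : rightHalfPlane => WithLp.toLp 2 ((1 : ℂ), Z (primePoint s s.2) (κ s)))
    (fun s : rightHalfPlane => WithLp.toLp 2 (f s, κ s)) (fun s w => by
      simp only [WithLp.prod_inner_apply]
      have h1 := lp.hasSum_inner (𝕜 := ℂ) (κ s) (κ w)
      have h2 := lp.hasSum_inner (𝕜 := ℂ) (Z (primePoint s s.2) (κ s))
        (Z (primePoint w w.2) (κ w))
      have h3 := (h1.sub h2).unique ((hf s w).congr_fun ?_)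
      · simp only [RCLike.inner_apply, map_one, mul_one]
        linear_combination -h3
      · intro j
        simp only [Z, diagonalOp_apply, inner_smul_left, inner_smul_right]
        rw [prm_cpow_neg_add_conj]
        simp only [hκ, primePoint, ZeroAtInftyContinuousMap.coe_mk]
        ring)
  set S := Colligation.ofContraction V hV
  -- The blocks `a, B, c, D` of `S N` do not depend on `N`, only the projections `E` do; `S 0`
  -- serves to name them.
  set a : ℂ := (S 0).a
  set c : lp H 2 := (S 0).c
  set B : lp H 2 →L[ℂ] ℂ := (S 0).B
  set D : lp H 2 →L[ℂ] lp H 2 := (S 0).D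
  set G : C₀(ℕ, ℂ) → ℂ := fun z => a + B (Z z (Ring.inverse (1 - D * Z z) c)) with hG
  have hDZ : ∀ z : C₀(ℕ, ℂ), ‖z‖ < 1 → ‖D * Z z‖ < 1 := fun z hz =>
    calc _ ≤ ‖D‖ * ‖Z z‖ := norm_mul_le _ _
      _ ≤ 1 * ‖z‖ := mul_le_mul (S 0).norm_D_le (norm_diagonalOp_le z) (norm_nonneg _) zero_le_one
      _ < 1 := by rwa [one_mul]
  classical
  -- `F` must accept arbitrary sequences; off `c₀` its value is immaterial and is set to `0`.
  refine ⟨fun v => if h : ∃ g : C₀(ℕ, ℂ), ⇑g = v then G h.choose else 0, fun N => ?_, G, ?_, ?_, ?_⟩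
  · have : (fun z : Fin N → ℂ => if h : ∃ g : C₀(ℕ, ℂ), ⇑g = padZero z then G h.choose else 0) =
        (S N).transfer := by
      funext z
      have hex : ∃ g : C₀(ℕ, ℂ), ⇑g = padZero z := ⟨padC0 z, rfl⟩
      have hch : hex.choose = padC0 z := DFunLike.coe_injective hex.choose_spec
      rw [dif_pos hex, hch, Colligation.transfer, ← diagonalOp_padC0]
      rfl
    rw [this]
    exact (S N).memAgler_transfer
  · intro z hz
    have hz' : ‖z‖ < 1 := by simpa using hz
    refine DifferentiableAt.differentiableWithinAt ?_
    have h1 : DifferentiableAt ℂ (fun z => Z z) z := Z.differentiableAt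
    have h2 : DifferentiableAt ℂ (fun z => Ring.inverse (1 - D * Z z)) z :=
      DifferentiableAt.comp z (g := Ring.inverse) (f := fun z => 1 - D * Z z)
        (differentiableAt_inverse (isUnit_one_sub_of_norm_lt_one (hDZ z hz')))
        ((differentiableAt_const _).sub ((differentiableAt_const D).mul h1))
    have h3 := (h1.mul h2)
    exact (differentiableAt_const a).add
      ((B ∘L ContinuousLinearMap.apply ℂ (lp H 2) c).differentiableAt.comp z h3)
  · intro z _ _
    have hex : ∃ g : C₀(ℕ, ℂ), ⇑g = z := ⟨z, rfl⟩
    have hch : hex.choose = z := DFunLike.coe_injective hex.choose_spec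
    simp only [dif_pos hex, hch]
  · intro s hs
    set z := primePoint s hs
    have hx := hVx ⟨s, hs⟩
    set h := Z z (κ ⟨s, hs⟩)
    have e : V (WithLp.toLp 2 ((1 : ℂ), h)) =
        V (WithLp.toLp 2 (1, 0)) + V (WithLp.toLp 2 (0, h)) := by
      rw [← map_add, ← WithLp.toLp_add]
      simp
    have hx' : V (WithLp.toLp 2 (1, 0)) + V (WithLp.toLp 2 (0, h)) =
        WithLp.toLp 2 (f s, κ ⟨s, hs⟩) := e.symm.trans hx
    have hx1 : a + B h = f s := congrArg WithLp.fst hx'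
    have hx2 : c + D h = κ ⟨s, hs⟩ := congrArg WithLp.snd hx'
    -- The second component of the isometry, `c + D Z κ_s = κ_s`, identifies `κ_s` as `(1 - D Z)⁻¹
    -- c`; the first component then reads `G = f`.
    have hinv : Ring.inverse (1 - D * Z z) c = κ ⟨s, hs⟩ := by
      have hc : c = (1 - D * Z z) (κ ⟨s, hs⟩) := eq_sub_of_add_eq hx2
      have := Ring.inverse_mul_cancel _
        (isUnit_one_sub_of_norm_lt_one (hDZ z (norm_primePoint_lt_one s hs)))
      rw [hc]
      exact congrArg (fun A : lp H 2 →L[ℂ] lp H 2 => A (κ ⟨s, hs⟩)) this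
    rw [hG]
    simp only [hinv]
    exact hx1.symm

end HilbertSum

/-! ### Hilbert spaces of positive semi-definite kernels -/

/-- The operator valued version of a scalar kernel. -/
def operatorKernel {X : Type*} (M : Matrix X X ℂ) : Matrix X X (ℂ →L[ℂ] ℂ) :=
  Matrix.of fun x y => M x y • (1 : ℂ →L[ℂ] ℂ)

theorem posSemidef_operatorKernel {X : Type*} {M : Matrix X X ℂ} (hM : M.PosSemidef) :
    (operatorKernel M).PosSemidef := by
  have h := (RKHS.posSemidef_tfae (K := operatorKernel M)).out 0 2
  refine h.2 ⟨?_, fun v => ?_⟩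
  · ext x y
    have := congrFun (congrFun hM.1 x) y
    rw [Matrix.conjTranspose_apply] at this
    simp [operatorKernel, Matrix.conjTranspose_apply, ← this]
  · have := hM.2 v
    refine (Complex.le_def.1 this).1.trans_eq ?_
    rw [RCLike.re_eq_complex_re]
    simp only [Finsupp.sum, operatorKernel]
    rw [← Complex.conj_re, map_sum, Finset.sum_comm]
    simp only [map_sum]
    refine congrArg Complex.re (Finset.sum_congr rfl fun x _ => Finset.sum_congr rfl fun y _ => ?_)
    simp
    ring

theorem inner_kerFun_operatorKernel {X : Type*} (M : Matrix X X ℂ)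
    [Fact (operatorKernel M).PosSemidef] (x y : X) :
    inner ℂ (RKHS.kerFun (RKHS.OfKernel (operatorKernel M)) x (1 : ℂ))
      (RKHS.kerFun (RKHS.OfKernel (operatorKernel M)) y (1 : ℂ)) = conj (M y x) := by
  rw [← RKHS.kernel_inner, RKHS.OfKernel.kernel_ofKernel]
  simp [operatorKernel]

theorem memBohrAgler_of_hasAglerDecomposition {f : ℂ → ℂ} (hf : HasAglerDecomposition f) :
    MemBohrAgler f := by
  obtain ⟨K, hK, hsum, hdiag⟩ := hf
  set M : ℕ → Matrix rightHalfPlane rightHalfPlane ℂ := fun j => Matrix.of fun s w => K j s w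
  -- The inner product is conjugate linear in its first slot; with the transposed kernel the Gram
  -- vectors satisfy `⟪k_s, k_w⟫ = K_j(w, s)`.
  have hM : ∀ j, (M j).transpose.PosSemidef := fun j => (isPSDOn_iff.1 (hK j)).transpose
  have : ∀ j, Fact (operatorKernel (M j).transpose).PosSemidef :=
    fun j => ⟨posSemidef_operatorKernel (hM j)⟩
  have hin : ∀ j (s w : rightHalfPlane),
      inner ℂ (RKHS.kerFun (RKHS.OfKernel (operatorKernel (M j).transpose)) s (1 : ℂ))
        (RKHS.kerFun (RKHS.OfKernel (operatorKernel (M j).transpose)) w (1 : ℂ)) = K j w s := by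
    intro j s w
    rw [inner_kerFun_operatorKernel]
    exact congrFun (congrFun (hM j).1 s) w
  refine memBohrAgler_of_gram
    (fun s j => RKHS.kerFun (RKHS.OfKernel (operatorKernel (M j).transpose)) s (1 : ℂ))
    (fun s => ?_) (fun s w => ?_)
  · have := (Complex.reCLM.summable (hdiag s s.2))
    refine this.congr fun j => ?_
    rw [← hin, Complex.reCLM_apply, ← RCLike.re_eq_complex_re, inner_self_eq_norm_sq]
  · simp only [hin]
    exact hsum w w.2 s s.2

/-! ### Functions of diagonalizable matrices -/

section Conj

variable {d : ℕ} (P : Matrix (Fin d) (Fin d) ℂ)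

theorem natPowNeg_conj_diagonal (hP : IsUnit P.det) (l : Fin d → ℂ) {n : ℕ} (hn : 1 ≤ n) :
    natPowNeg n (P * Matrix.diagonal l * P⁻¹) =
      P * Matrix.diagonal (fun i => (n : ℂ) ^ (-l i)) * P⁻¹ := by
  have hPu : IsUnit P := (Matrix.isUnit_iff_isUnit_det P).2 hP
  have e : -((Real.log n : ℝ) : ℂ) • (P * Matrix.diagonal l * P⁻¹) =
      P * Matrix.diagonal (-((Real.log n : ℝ) : ℂ) • l) * P⁻¹ := by
    rw [Matrix.diagonal_smul, Matrix.mul_smul, Matrix.smul_mul]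
  rw [natPowNeg, e, Matrix.exp_conj P _ hPu, Matrix.exp_diagonal]
  congr 3
  funext i
  rw [Pi.coe_exp, ← Complex.exp_eq_exp_ℂ, Complex.cpow_def_of_ne_zero (by exact_mod_cast (by lia))]
  simp

theorem spectrum_conj_diagonal (hP : IsUnit P.det) (l : Fin d → ℂ) :
    spectrum ℂ (P * Matrix.diagonal l * P⁻¹) = Set.range l := by
  obtain ⟨u, rfl⟩ : IsUnit P := (Matrix.isUnit_iff_isUnit_det P).2 hP
  rw [← Matrix.coe_units_inv, spectrum.units_conjugate, spectrum_diagonal]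

/-- The algebra homomorphism `μ ↦ P diag(μ) P⁻¹` into the operators on Euclidean space. -/
def conjDiagonalHom (hP : IsUnit P.det) :
    (Fin d → ℂ) →ₐ[ℂ] (EuclideanSpace ℂ (Fin d) →L[ℂ] EuclideanSpace ℂ (Fin d)) :=
  AlgHom.ofLinearMap
    { toFun := fun μ => Matrix.toEuclideanCLM (n := Fin d) (𝕜 := ℂ) (P * Matrix.diagonal μ * P⁻¹)
      map_add' := fun μ ν => by
        rw [← map_add, ← add_mul, ← mul_add, Matrix.diagonal_add]; rfl
      map_smul' := fun t μ => by
        rw [RingHom.id_apply, ← map_smul, Matrix.diagonal_smul, Matrix.mul_smul, Matrix.smul_mul] }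
    (by
      change Matrix.toEuclideanCLM (n := Fin d) (𝕜 := ℂ) (P * Matrix.diagonal 1 * P⁻¹) = 1
      rw [show Matrix.diagonal (1 : Fin d → ℂ) = 1 from Matrix.diagonal_one, mul_one,
        Matrix.mul_nonsing_inv P hP, map_one])
    (fun μ ν => by
      change Matrix.toEuclideanCLM (n := Fin d) (𝕜 := ℂ) _ =
        Matrix.toEuclideanCLM (n := Fin d) (𝕜 := ℂ) _ *
          Matrix.toEuclideanCLM (n := Fin d) (𝕜 := ℂ) _
      rw [← map_mul]
      congr 1
      calc P * Matrix.diagonal (μ * ν) * P⁻¹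
          = P * (Matrix.diagonal μ * Matrix.diagonal ν) * P⁻¹ := by
            rw [Matrix.diagonal_mul_diagonal]; rfl
        _ = P * Matrix.diagonal μ * (P⁻¹ * P) * Matrix.diagonal ν * P⁻¹ := by
            rw [Matrix.nonsing_inv_mul P hP, mul_one]; simp only [mul_assoc]
        _ = _ := by simp only [mul_assoc])

theorem norm_conjDiagonalHom (hP : IsUnit P.det) (μ : Fin d → ℂ) :
    ‖conjDiagonalHom P hP μ‖ = opNorm (P * Matrix.diagonal μ * P⁻¹) := rfl

theorem continuous_conjDiagonalHom (hP : IsUnit P.det) : Continuous (conjDiagonalHom P hP) :=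
  (conjDiagonalHom P hP).toLinearMap.continuous_of_finiteDimensional

theorem opMonomial_conjDiagonalHom (hP : IsUnit P.det) {N : ℕ} (w : Fin N → Fin d → ℂ)
    (α : Fin N → ℕ) : opMonomial (fun j => conjDiagonalHom P hP (w j)) α =
      conjDiagonalHom P hP (fun i => ∏ j, w j i ^ α j) := by
  have : (fun j => conjDiagonalHom P hP (w j) ^ α j) =
      conjDiagonalHom P hP ∘ fun j => w j ^ α j := by
    funext j
    simp
  rw [opMonomial, this, ← List.map_ofFn, ← map_list_prod, List.prod_ofFn]
  congr 1
  funext i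
  simp

/-- `μ ↦ P diag(μ) P⁻¹` is a continuous algebra homomorphism, so it carries the scalar power series
at the points `w i` to the power series in the commuting matrices. -/
theorem MemAgler.norm_conjDiagonalHom_le {N : ℕ} {g : (Fin N → ℂ) → ℂ} (hg : MemAgler N g)
    (hP : IsUnit P.det) (w : Fin d → Fin N → ℂ) (hw : ∀ i, ‖w i‖ < 1)
    (hT : ∀ j, ‖conjDiagonalHom P hP fun i => w i j‖ < 1) :
    ‖conjDiagonalHom P hP fun i => g (w i)‖ ≤ 1 := by
  obtain ⟨c, hc, hvN⟩ := hg.vonNeumann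
  have h := (hvN _ (fun j => conjDiagonalHom P hP fun i => w i j) hT fun j k => by
    rw [Commute, SemiconjBy, ← map_mul, ← map_mul, mul_comm]).2
  have hs : HasSum (fun α : Fin N → ℕ => fun i => c α * ∏ j, w i j ^ α j) fun i => g (w i) :=
    Pi.hasSum.2 fun i => hc _ (by simpa using hw i)
  have hs' := hs.map (conjDiagonalHom P hP) (continuous_conjDiagonalHom P hP)
  rw [← hs'.tsum_eq]
  convert h using 4 with α
  rw [opMonomial_conjDiagonalHom, ← map_smul]
  rfl

end Conj

/-! ### From the Agler class to the matrix inequality -/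

/-- Truncation costs only the tail of the null sequence `p_j^{-s}`. The factor `1 - 1/(N+1)` is
there to turn contractions into strict ones. -/
theorem tendsto_padC0_primePoint (s : ℂ) (hs : s ∈ rightHalfPlane) :
    Tendsto (fun N : ℕ => padC0 fun j : Fin N => (1 - 1 / ((N : ℂ) + 1)) * (prm j : ℂ) ^ (-s))
      atTop (𝓝 (primePoint s hs)) := by
  rw [Metric.tendsto_atTop]
  intro ε hε
  obtain ⟨N₁, h₁⟩ := Metric.tendsto_atTop.1 (tendsto_prm_cpow hs) (ε / 2) (by linarith)
  obtain ⟨N₂, h₂⟩ := exists_nat_one_div_lt (half_pos hε)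
  refine ⟨max N₁ N₂, fun N hN => ?_⟩
  rw [dist_eq_norm]
  refine (norm_le_of_apply_le (half_pos hε).le fun j => ?_).trans_lt (half_lt_self hε)
  rw [ZeroAtInftyContinuousMap.sub_apply, padC0_apply]
  change ‖_ - (prm j : ℂ) ^ (-s)‖ ≤ _
  by_cases hj : j < N
  · have e : padZero (fun j : Fin N => (1 - 1 / ((N : ℂ) + 1)) * (prm j : ℂ) ^ (-s)) j -
        (prm j : ℂ) ^ (-s) = -(((1 / ((N : ℝ) + 1) : ℝ) : ℂ) * (prm j : ℂ) ^ (-s)) := by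
      simp [padZero, hj]; ring
    rw [e, norm_neg, norm_mul, Complex.norm_real, Real.norm_of_nonneg (by positivity)]
    have h3 : 1 / ((N : ℝ) + 1) ≤ 1 / ((N₂ : ℝ) + 1) := by
      have : (N₂ : ℝ) ≤ N := by exact_mod_cast (le_max_right _ _).trans hN
      gcongr
    exact (mul_le_of_le_one_right (by positivity) (norm_prm_cpow_lt_one hs j).le).trans
      (h3.trans h₂.le)
  · have := h₁ j (((le_max_left _ _).trans hN).trans (not_lt.1 hj))
    rw [dist_zero_right] at this
    simpa [padZero, hj] using this.le

theorem satisfiesMatrixVonNeumann_of_memBohrAgler {f : ℂ → ℂ} (hf : MemBohrAgler f) :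
    SatisfiesMatrixVonNeumann f := by
  obtain ⟨F, hF, G, hG, hGF, hGf⟩ := hf
  rintro d M ⟨P, l, hP, rfl⟩ - hspec hM
  have hl : ∀ i, l i ∈ rightHalfPlane := fun i =>
    hspec (by rw [spectrum_conj_diagonal P hP]; exact ⟨i, rfl⟩)
  rw [funMatrix_conj_diagonal f P hP, ← norm_conjDiagonalHom P hP]
  have hr : ∀ N : ℕ, ‖(1 - 1 / ((N : ℂ) + 1))‖ < 1 := fun N => by
    have : (1 - 1 / ((N : ℂ) + 1)) = ((1 - 1 / ((N : ℝ) + 1) : ℝ) : ℂ) := by push_cast; ring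
    rw [this, Complex.norm_real, Real.norm_of_nonneg]
    · have : 0 < 1 / ((N : ℝ) + 1) := by positivity
      linarith
    · have : 1 / ((N : ℝ) + 1) ≤ 1 := by
        rw [div_le_one (by positivity)]; linarith [Nat.cast_nonneg (α := ℝ) N]
      linarith
  set w : ∀ N : ℕ, Fin d → Fin N → ℂ := fun N i j =>
    (1 - 1 / ((N : ℂ) + 1)) * (prm j : ℂ) ^ (-l i) with hw
  have hw1 : ∀ N i, ‖w N i‖ < 1 := fun N i => by
    rw [pi_norm_lt_iff one_pos]
    intro j
    rw [hw, norm_mul]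
    exact mul_lt_one_of_nonneg_of_lt_one_left (norm_nonneg _) (hr N)
      (norm_prm_cpow_lt_one (hl i) j).le
  have hbound : ∀ N, ‖conjDiagonalHom P hP fun i => F (padZero (w N i))‖ ≤ 1 := fun N => by
    refine MemAgler.norm_conjDiagonalHom_le P (hF N) hP (w N) (hw1 N) fun j => ?_
    have e : (fun i => w N i j) =
        (1 - 1 / ((N : ℂ) + 1)) • fun i => (prm j : ℂ) ^ (-l i) := rfl
    have hp : 1 ≤ prm j := by have := two_le_prm j; lia
    have hc := hM (prm j) hp
    rw [natPowNeg_conj_diagonal P hP l hp, ← norm_conjDiagonalHom P hP] at hc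
    rw [e, map_smul, norm_smul]
    exact mul_lt_one_of_nonneg_of_lt_one_left (norm_nonneg _) (hr N) hc
  have hlim : Tendsto (fun N => fun i => F (padZero (w N i))) atTop (𝓝 fun i => f (l i)) := by
    rw [tendsto_pi_nhds]
    intro i
    have hmem : primePoint (l i) (hl i) ∈ Metric.ball (0 : C₀(ℕ, ℂ)) 1 := by
      simpa using norm_primePoint_lt_one (l i) (hl i)
    have hcont := (hG.differentiableAt (Metric.isOpen_ball.mem_nhds hmem)).continuousAt
    rw [hGf (l i) (hl i)]
    have ht := tendsto_padC0_primePoint (l i) (hl i)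
    refine (hcont.tendsto.comp ht).congr' ?_
    filter_upwards [ht.eventually (Metric.isOpen_ball.mem_nhds hmem)] with N hN
    exact hGF _ hN (finite_support_padC0 _)
  exact le_of_tendsto (((continuous_conjDiagonalHom P hP).tendsto _).comp hlim).norm
    (Eventually.of_forall hbound)

/-! ### Diagonalizable matrices adapted to a Gram matrix -/

section Gram

open Matrix

variable {d : ℕ} (R : Matrix (Fin d) (Fin d) ℂ)

theorem star_dotProduct_conjTranspose_mul_mulVec (A : Matrix (Fin d) (Fin d) ℂ) (y : Fin d → ℂ) :
    star y ⬝ᵥ ((Aᴴ * A) *ᵥ y) =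
      ((‖(WithLp.toLp 2 (A *ᵥ y) : EuclideanSpace ℂ (Fin d))‖ ^ 2 : ℝ) : ℂ) := by
  rw [← mulVec_mulVec, dotProduct_mulVec, ← star_mulVec, EuclideanSpace.norm_sq_eq,
    Complex.ofReal_sum]
  refine Finset.sum_congr rfl fun i _ => ?_
  rw [Pi.star_apply, Complex.star_def, Complex.conj_mul', Complex.ofReal_pow]

/-- In the coordinates `x = R y`, the kernel on the right is the quadratic form `‖R y‖² - ‖R diag(μ)
y‖²`. -/
theorem opNorm_conj_diagonal_le_one_iff (hR : IsUnit R.det) (μ : Fin d → ℂ) :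
    opNorm (R * diagonal μ * R⁻¹) ≤ 1 ↔
      (of fun i k => (1 - conj (μ i) * μ k) * (Rᴴ * R) i k).PosSemidef := by
  have e : (of fun i k => (1 - conj (μ i) * μ k) * (Rᴴ * R) i k) =
      Rᴴ * R - (R * diagonal μ)ᴴ * (R * diagonal μ) := by
    have : (R * diagonal μ)ᴴ * (R * diagonal μ) = diagonal (star μ) * (Rᴴ * R) * diagonal μ := by
      rw [conjTranspose_mul, diagonal_conjTranspose]; simp only [mul_assoc]
    rw [this]
    ext i k
    simp [sub_mul]
    ring
  have key : ∀ y, star y ⬝ᵥ ((Rᴴ * R - (R * diagonal μ)ᴴ * (R * diagonal μ)) *ᵥ y) =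
      ((‖(WithLp.toLp 2 (R *ᵥ y) : EuclideanSpace ℂ (Fin d))‖ ^ 2 -
        ‖(WithLp.toLp 2 ((R * diagonal μ) *ᵥ y) : EuclideanSpace ℂ (Fin d))‖ ^ 2 : ℝ) : ℂ) := by
    intro y
    rw [sub_mulVec, dotProduct_sub, star_dotProduct_conjTranspose_mul_mulVec,
      star_dotProduct_conjTranspose_mul_mulVec, Complex.ofReal_sub]
  rw [e]
  constructor
  · intro h
    refine PosSemidef.of_dotProduct_mulVec_nonneg
      ((isHermitian_conjTranspose_mul_self _).sub (isHermitian_conjTranspose_mul_self _))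
      fun y => ?_
    rw [key]
    have h1 := (Matrix.toEuclideanCLM (n := Fin d) (𝕜 := ℂ) (R * diagonal μ * R⁻¹)).le_of_opNorm_le
      h (WithLp.toLp 2 (R *ᵥ y))
    rw [toEuclideanCLM_toLp, mulVec_mulVec, mul_assoc, nonsing_inv_mul R hR, mul_one, one_mul] at h1
    exact_mod_cast sub_nonneg.2 (pow_le_pow_left₀ (norm_nonneg _) h1 2)
  · intro h
    refine ContinuousLinearMap.opNorm_le_bound _ zero_le_one fun x => ?_
    have h1 := h.dotProduct_mulVec_nonneg (R⁻¹ *ᵥ x.ofLp)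
    rw [key, mulVec_mulVec, mulVec_mulVec, mul_nonsing_inv R hR, one_mulVec] at h1
    rw [one_mul]
    exact abs_le_of_sq_le_sq' (sub_nonneg.1 (by exact_mod_cast h1)) (norm_nonneg _) |>.2

theorem hasSimpleEigenspaces_conj_diagonal (hR : IsUnit R.det) {l : Fin d → ℂ}
    (hl : Function.Injective l) : HasSimpleEigenspaces (R * diagonal l * R⁻¹) := by
  intro μ hμ
  have hmem : ∀ x, x ∈ Module.End.eigenspace (Matrix.toLin' (R * diagonal l * R⁻¹)) μ →
      ∀ i, l i * (R⁻¹ *ᵥ x) i = μ * (R⁻¹ *ᵥ x) i := by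
    intro x hx i
    rw [Module.End.mem_eigenspace_iff, toLin'_apply] at hx
    have h1 : diagonal l *ᵥ (R⁻¹ *ᵥ x) = μ • (R⁻¹ *ᵥ x) := by
      rw [← mulVec_smul, ← hx, mulVec_mulVec, mulVec_mulVec]
      simp only [← mul_assoc]
      rw [nonsing_inv_mul R hR, one_mul]
    have := congrFun h1 i
    rwa [mulVec_diagonal] at this
  obtain ⟨v, hv⟩ := hμ.exists_hasEigenvector
  have hback : ∀ x, R *ᵥ (R⁻¹ *ᵥ x) = x := fun x => by
    rw [mulVec_mulVec, mul_nonsing_inv R hR, one_mulVec]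
  have hv0 : R⁻¹ *ᵥ v ≠ 0 := fun h => hv.2 (by rw [← hback v, h, mulVec_zero])
  obtain ⟨i, hi⟩ := Function.ne_iff.1 hv0
  have hli : l i = μ := mul_right_cancel₀ hi (hmem v hv.1 i)
  have hzero : ∀ x ∈ Module.End.eigenspace (Matrix.toLin' (R * diagonal l * R⁻¹)) μ,
      ∀ j, j ≠ i → (R⁻¹ *ᵥ x) j = 0 := fun x hx j hj => by
    by_contra h0
    exact hj (hl ((mul_right_cancel₀ h0 (hmem x hx j)).trans hli.symm))
  refine finrank_eq_one_iff'.2 ⟨⟨v, hv.1⟩, fun h => hv.2 (congrArg Subtype.val h), fun x => ?_⟩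
  set t := (R⁻¹ *ᵥ (x : Fin d → ℂ)) i / (R⁻¹ *ᵥ v) i with ht
  have hx : t • (R⁻¹ *ᵥ v) = R⁻¹ *ᵥ (x : Fin d → ℂ) := ?_
  · refine ⟨t, Subtype.ext ?_⟩
    change t • v = (x : Fin d → ℂ)
    rw [← hback x, ← hx, mulVec_smul, hback]
  funext j
  rw [Pi.smul_apply, smul_eq_mul]
  by_cases hj : j = i
  · subst hj
    exact div_mul_cancel₀ _ hi
  · rw [hzero v hv.1 j hj, hzero x x.2 j hj, mul_zero]

/-- `n ↦ n^{-M}` is multiplicative, so contractivity at the primes suffices. -/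
theorem opNorm_natPowNeg_le_one (hR : IsUnit R.det) (l : Fin d → ℂ)
    (h : ∀ j, opNorm (R * diagonal (fun i => (prm j : ℂ) ^ (-l i)) * R⁻¹) ≤ 1) (n : ℕ)
    (hn : 1 ≤ n) : opNorm (natPowNeg n (R * diagonal l * R⁻¹)) ≤ 1 := by
  rw [natPowNeg_conj_diagonal R hR l hn, ← norm_conjDiagonalHom R hR]
  induction n using induction_on_primes with
  | zero => lia
  | one =>
    have : (fun i => ((1 : ℕ) : ℂ) ^ (-l i)) = 1 := by funext i; simp
    rw [this, map_one]
    exact ContinuousLinearMap.norm_id_le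
  | prime_mul p a hp ih =>
    have hmul : (fun i => ((p * a : ℕ) : ℂ) ^ (-l i)) =
        (fun i => (p : ℂ) ^ (-l i)) * fun i => (a : ℂ) ^ (-l i) := by
      funext i
      rw [Nat.cast_mul, Complex.natCast_mul_natCast_cpow]; rfl
    have hpj : prm (Nat.count Nat.Prime p) = p := Nat.nth_count hp
    have hp' := h (Nat.count Nat.Prime p)
    rw [hpj, ← norm_conjDiagonalHom R hR] at hp'
    rw [hmul, map_mul]
    exact (norm_mul_le _ _).trans (mul_le_one₀ hp' (norm_nonneg _)
      (ih (Nat.pos_of_mul_pos_left (by lia : 0 < p * a))))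

/-- Representation of a real functional on Hermitian matrices. -/
theorem exists_hermitian_of_functional (φ : (Fin d → Fin d → ℂ) →ₗ[ℝ] ℝ) :
    ∃ Γ : Matrix (Fin d) (Fin d) ℂ, Γ.IsHermitian ∧ ∀ H : Fin d → Fin d → ℂ,
      (∀ i k, conj (H i k) = H k i) → ((φ H : ℝ) : ℂ) = ∑ i, ∑ k, H i k * Γ k i := by
  set ε : Fin d → Fin d → ℂ → Fin d → Fin d → ℂ := fun i k z => Pi.single i (Pi.single k z) with hε
  set ℓ : Fin d → Fin d → ℂ := fun i k => φ (ε i k 1) - Complex.I * φ (ε i k Complex.I) with hℓ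
  have hεz : ∀ i k z, φ (ε i k z) = (z * ℓ i k).re := by
    intro i k z
    have : ε i k z = z.re • ε i k 1 + z.im • ε i k Complex.I := by
      simp only [hε, ← Pi.single_smul, ← Pi.single_add]
      congr 2
      simp
    rw [this, map_add, map_smul, map_smul]
    simp [hℓ]
  -- `φ H` is the real part of `∑ H i k * ℓ i k`; for Hermitian `H`, taking the real part amounts to
  -- symmetrizing the coefficients.
  refine ⟨of fun k i => (ℓ i k + conj (ℓ k i)) / 2, ?_, fun H hH => ?_⟩
  · ext k i
    simp [conjTranspose_apply, add_comm]
  · have hsum : H = ∑ i, ∑ k, ε i k (H i k) := by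
      funext a b
      simp only [hε, Finset.sum_apply]
      rw [Finset.sum_eq_single a (fun i _ hi => by simp [hi.symm]) (by simp)]
      rw [Finset.sum_eq_single b (fun i _ hi => by simp [hi.symm]) (by simp)]
      simp
    have h1 : φ H = ∑ i, ∑ k, (H i k * ℓ i k).re := by
      conv_lhs => rw [hsum]
      simp only [map_sum, hεz]
    have h2 : ((φ H : ℝ) : ℂ) = ∑ i, ∑ k, (H i k * ℓ i k + conj (H i k * ℓ i k)) / 2 := by
      rw [h1]
      push_cast
      refine Finset.sum_congr rfl fun i _ => Finset.sum_congr rfl fun k _ => ?_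
      rw [Complex.re_eq_add_conj]
    rw [h2]
    simp only [add_div, Finset.sum_add_distrib, of_apply, mul_add, mul_div_assoc']
    congr 1
    rw [Finset.sum_comm]
    refine Finset.sum_congr rfl fun i _ => Finset.sum_congr rfl fun k _ => ?_
    rw [map_mul, hH]

end Gram

/-! ### Finite sets: separation from the cone of decomposable kernels -/

section Cone

variable {ι : Type*} (q : ℕ → ι → ℂ)

/-- The kernels `∑_j (1 - q_j(s) conj(q_j(w))) K_j(s, w)` with `K_j` positive semi-definite. -/
def decomposableCone : Set (ι → ι → ℂ) :=
  {H | ∃ K : ℕ → Matrix ι ι ℂ, (∀ j, (K j).PosSemidef) ∧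
    ∀ s w, HasSum (fun j => (1 - q j s * conj (q j w)) * K j s w) (H s w)}

variable {q}

theorem zero_mem_decomposableCone : 0 ∈ decomposableCone q :=
  ⟨fun _ => 0, fun _ => Matrix.PosSemidef.zero, fun s w => by simp⟩

theorem smul_mem_decomposableCone {H : ι → ι → ℂ} (hH : H ∈ decomposableCone q) {t : ℝ}
    (ht : 0 ≤ t) : t • H ∈ decomposableCone q := by
  obtain ⟨K, hK, hs⟩ := hH
  refine ⟨fun j => t • K j, fun j => (hK j).smul ht, fun s w => ?_⟩
  refine ((hs s w).const_smul t).congr_fun fun j => ?_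
  exact mul_smul_comm t (1 - q j s * conj (q j w)) (K j s w)

theorem add_mem_decomposableCone {H H' : ι → ι → ℂ} (hH : H ∈ decomposableCone q)
    (hH' : H' ∈ decomposableCone q) : H + H' ∈ decomposableCone q := by
  obtain ⟨K, hK, hs⟩ := hH
  obtain ⟨K', hK', hs'⟩ := hH'
  refine ⟨fun j => K j + K' j, fun j => (hK j).add (hK' j), fun s w => ?_⟩
  simpa [mul_add] using (hs s w).add (hs' s w)

theorem convex_decomposableCone : Convex ℝ (decomposableCone q) :=
  fun _ hH _ hH' _ _ ha hb _ => add_mem_decomposableCone (smul_mem_decomposableCone hH ha)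
    (smul_mem_decomposableCone hH' hb)

theorem mul_mem_decomposableCone {M : Matrix ι ι ℂ} (hM : M.PosSemidef) (j : ℕ) :
    (fun s w => (1 - q j s * conj (q j w)) * M s w) ∈ decomposableCone q := by
  refine ⟨fun i => if i = j then M else 0, fun i => ?_, fun s w => ?_⟩
  · dsimp only
    split_ifs
    exacts [hM, Matrix.PosSemidef.zero]
  · convert hasSum_ite_eq j ((1 - q j s * conj (q j w)) * M s w) using 2 with i
    by_cases h : i = j
    · subst h; simp
    · simp [h]

theorem one_sub_mul_conj_ne_zero {a b : ℂ} (ha : ‖a‖ < 1) (hb : ‖b‖ < 1) :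
    1 - a * conj b ≠ 0 := by
  intro h
  have h1 : ‖a * conj b‖ < 1 := by
    rw [norm_mul, RCLike.norm_conj]
    exact mul_lt_one_of_nonneg_of_lt_one_left (norm_nonneg _) ha hb.le
  rw [← sub_eq_zero.1 h, norm_one] at h1
  exact lt_irrefl _ h1

/-- Take `K_0` to be the Schur product of `M` with the Szegő kernel of `q 0`, and all other kernels
zero. -/
theorem mem_decomposableCone_of_posSemidef (hq : ∀ s, ‖q 0 s‖ < 1) {M : Matrix ι ι ℂ}
    (hM : M.PosSemidef) : (fun s w => M s w) ∈ decomposableCone q := by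
  have := mul_mem_decomposableCone (q := q) ((posSemidef_one_sub_inv (q 0) hq).hadamard hM) 0
  convert this using 3 with s w
  rw [Matrix.hadamard_apply, Matrix.of_apply, mul_inv_cancel_left₀
    (one_sub_mul_conj_ne_zero (hq s) (hq w))]

/-- This makes the trace nonnegative on the cone, so adding a multiple of it to a separating
functional is harmless there. -/
theorem re_diag_nonneg_of_mem_decomposableCone (hq : ∀ j s, ‖q j s‖ < 1) {H : ι → ι → ℂ}
    (hH : H ∈ decomposableCone q) (s : ι) : 0 ≤ (H s s).re := by
  obtain ⟨K, hK, hs⟩ := hH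
  refine hasSum_le (fun j => ?_) hasSum_zero ((hs s s).mapL Complex.reCLM)
  have h1 : (1 - q j s * conj (q j s)) = ((1 - ‖q j s‖ ^ 2 : ℝ) : ℂ) := by
    rw [Complex.mul_conj']; push_cast; rfl
  have h2 := (Complex.le_def.1 ((hK j).diag_nonneg (i := s))).1
  rw [Complex.reCLM_apply, h1, Complex.re_ofReal_mul]
  have := pow_le_one₀ (norm_nonneg _) (hq j s).le (n := 2)
  exact mul_nonneg (by linarith) h2

end Cone

theorem mem_closure_decomposableCone {f : ℂ → ℂ} (hf : SatisfiesMatrixVonNeumann f) {d : ℕ}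
    {l : Fin d → ℂ} (hl : Function.Injective l) (hl0 : ∀ i, l i ∈ rightHalfPlane) :
    (fun i k => 1 - f (l i) * conj (f (l k))) ∈
      closure (decomposableCone fun j i => (prm j : ℂ) ^ (-l i)) := by
  set q : ℕ → Fin d → ℂ := fun j i => (prm j : ℂ) ^ (-l i) with hq
  set Δ : Fin d → Fin d → ℂ := fun i k => 1 - f (l i) * conj (f (l k)) with hΔ
  have hq1 : ∀ j i, ‖q j i‖ < 1 := fun j i => norm_prm_cpow_lt_one (hl0 i) j
  by_contra hmem
  obtain ⟨L, u, hLΔ, hL⟩ := geometric_hahn_banach_point_closed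
    (convex_decomposableCone (q := q)).closure isClosed_closure hmem
  have hu : u < 0 := by simpa using hL 0 (subset_closure zero_mem_decomposableCone)
  have hL0 : ∀ H ∈ decomposableCone q, 0 ≤ L H := by
    intro H hH
    by_contra hneg
    rw [not_le] at hneg
    -- Rescaled by `u / L H`, the element would have `L`-value exactly `u`, against the strict
    -- separation.
    have := hL _ (subset_closure (smul_mem_decomposableCone hH
      (div_nonneg_of_nonpos hu.le hneg.le : 0 ≤ u / L H)))
    rw [map_smul, smul_eq_mul, div_mul_cancel₀ _ hneg.ne] at this
    exact lt_irrefl _ this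
  set τ : (Fin d → Fin d → ℂ) →ₗ[ℝ] ℝ :=
    { toFun := fun H => ∑ i, (H i i).re
      map_add' := fun H H' => by simp [Finset.sum_add_distrib]
      map_smul' := fun t H => by simp [Finset.mul_sum] }
  have hτ : ∀ H, τ H = ∑ i, (H i i).re := fun H => rfl
  -- Small enough that `φ Δ ≤ L Δ / 2 < 0`. The trace term makes `φ` strictly positive on nonzero
  -- rank-one kernels, hence `Γ` positive definite and `R` invertible.
  set η : ℝ := -(L Δ) / (2 * (|τ Δ| + 1)) with hη
  have hη0 : 0 < η := div_pos (by linarith) (by positivity)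
  set φ : (Fin d → Fin d → ℂ) →ₗ[ℝ] ℝ := (L : (Fin d → Fin d → ℂ) →ₗ[ℝ] ℝ) + η • τ
  have hφ : ∀ H, φ H = L H + η * τ H := fun H => rfl
  have hφΔ : φ Δ < 0 := by
    have h1 : η * τ Δ ≤ -(L Δ) / 2 := by
      calc η * τ Δ ≤ η * (|τ Δ| + 1) := by
            gcongr; linarith [le_abs_self (τ Δ)]
        _ = -(L Δ) / 2 := by rw [hη]; field_simp
    rw [hφ]
    linarith
  have hφ0 : ∀ H ∈ decomposableCone q, 0 ≤ φ H := fun H hH => by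
    rw [hφ, hτ]
    exact add_nonneg (hL0 H hH) (mul_nonneg hη0.le (Finset.sum_nonneg fun i _ =>
      re_diag_nonneg_of_mem_decomposableCone hq1 hH i))
  obtain ⟨Γ, hΓ, hφΓ⟩ := exists_hermitian_of_functional φ
  have hrank : ∀ y : Fin d → ℂ, (Matrix.of fun i k => y i * conj (y k)).PosSemidef := fun y => by
    have := posSemidef_inner (E := ℂ) fun i => conj (y i)
    convert this using 3 with i k
    simp [mul_comm]
  have hpos : Γ.PosDef := by
    refine Matrix.PosDef.of_dotProduct_mulVec_pos hΓ fun {y} hy => ?_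
    have h1 : star y ⬝ᵥ (Γ.mulVec y) = ((φ fun i k => y i * conj (y k) : ℝ) : ℂ) := by
      rw [hφΓ _ (fun i k => by simp [mul_comm]), Finset.sum_comm]
      simp only [dotProduct, Matrix.mulVec, Finset.mul_sum]
      refine Finset.sum_congr rfl fun k _ => Finset.sum_congr rfl fun i _ => ?_
      simp
      ring
    rw [h1]
    have h2 : 0 < φ fun i k => y i * conj (y k) := by
      rw [hφ, hτ]
      refine add_pos_of_nonneg_of_pos
        (hL0 _ (mem_decomposableCone_of_posSemidef (hq1 0) (hrank y))) (mul_pos hη0 ?_)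
      obtain ⟨i, hi⟩ := Function.ne_iff.1 hy
      refine Finset.sum_pos' (fun i _ => ?_) ⟨i, Finset.mem_univ i, ?_⟩
      · rw [Complex.mul_conj']
        exact_mod_cast sq_nonneg ‖y i‖
      · rw [Complex.mul_conj']
        exact_mod_cast pow_pos (norm_pos_iff.2 hi) 2
    exact_mod_cast h2
  obtain ⟨R, hR⟩ : ∃ R : Matrix (Fin d) (Fin d) ℂ, Γ = R.conjTranspose * R := by
    open scoped MatrixOrder in
    exact CStarAlgebra.nonneg_iff_eq_star_mul_self.mp hpos.posSemidef.nonneg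
  have hRdet : IsUnit R.det := by
    have := (Matrix.isUnit_iff_isUnit_det _).1 hpos.isUnit
    rw [hR, Matrix.det_mul] at this
    exact isUnit_of_mul_isUnit_right this
  -- The quadratic form at `y` is `φ` evaluated at the cone element `(1 - q_j conj(q_j)) y conj(y)`.
  have hprm : ∀ j, opNorm (R * Matrix.diagonal (q j) * R⁻¹) ≤ 1 := fun j => by
    rw [opNorm_conj_diagonal_le_one_iff R hRdet, ← hR]
    refine Matrix.PosSemidef.of_dotProduct_mulVec_nonneg ?_ fun y => ?_
    · ext k i
      rw [Matrix.conjTranspose_apply, Matrix.of_apply, Matrix.of_apply, ← hΓ.apply k i]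
      simp [mul_comm]
    · have h1 := hφΓ (fun i k => (1 - q j i * conj (q j k)) * (y i * conj (y k)))
        (fun i k => by simp [mul_comm])
      have h2 := hφ0 _ (mul_mem_decomposableCone (q := q) (hrank y) j)
      have h3 : (0 : ℂ) ≤
          ((φ fun i k => (1 - q j i * conj (q j k)) * (y i * conj (y k)) : ℝ) : ℂ) :=
        by exact_mod_cast h2
      refine (h3.trans_eq h1).trans_eq ?_
      rw [Finset.sum_comm]
      simp only [dotProduct, Matrix.mulVec, Finset.mul_sum]
      refine Finset.sum_congr rfl fun k _ => Finset.sum_congr rfl fun i _ => ?_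
      simp
      ring
  have hvN := hf d (R * Matrix.diagonal l * R⁻¹) ⟨R, l, hRdet, rfl⟩
    (hasSimpleEigenspaces_conj_diagonal R hRdet hl)
    (by rw [spectrum_conj_diagonal R hRdet]; rintro _ ⟨i, rfl⟩; exact hl0 i)
    (opNorm_natPowNeg_le_one R hRdet l hprm)
  rw [funMatrix_conj_diagonal f R hRdet, opNorm_conj_diagonal_le_one_iff R hRdet, ← hR] at hvN
  -- Testing the resulting kernel on the constant vector `1` yields `φ Δ ≥ 0`.
  have h1 := posSemidef_iff_finset.1 hvN Finset.univ 1
  have h2 : (0 : ℂ) ≤ ((φ Δ : ℝ) : ℂ) := by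
    rw [hφΓ Δ (fun i k => by simp [hΔ, mul_comm]), Finset.sum_comm]
    refine h1.trans_eq (Finset.sum_congr rfl fun k _ => Finset.sum_congr rfl fun i _ => ?_)
    simp [hΔ, mul_comm]
  exact not_le.2 hφΔ (by exact_mod_cast h2)

/-- On finite sets, `1 - f(s) conj(f(w))` is approximated by finite decomposable sums. -/
theorem exists_approx_decomposition {f : ℂ → ℂ} (hf : SatisfiesMatrixVonNeumann f)
    (Y : Finset rightHalfPlane) {ε : ℝ} (hε : 0 < ε) :
    ∃ (J : ℕ) (K : ℕ → Matrix rightHalfPlane rightHalfPlane ℂ),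
      (∀ j, (K j).PosSemidef) ∧ (∀ j, J ≤ j → K j = 0) ∧ ∀ s ∈ Y, ∀ w ∈ Y,
        ‖(1 - f s * conj (f w)) - ∑ j ∈ Finset.range J,
          (1 - (prm j : ℂ) ^ (-(s : ℂ)) * conj ((prm j : ℂ) ^ (-(w : ℂ)))) * K j s w‖ < ε := by
  classical
  have h1mem : (1 : ℂ) ∈ rightHalfPlane := by simp [rightHalfPlane]
  -- The extra point makes the index set nonempty, so that `p` below has a default value. Pulling
  -- back along `p` extends the finite matrices to the half plane and keeps them positive
  -- semi-definite.
  set Y' : Finset rightHalfPlane := insert ⟨1, h1mem⟩ Y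
  set e := Y'.equivFin
  set l : Fin Y'.card → ℂ := fun i => ((e.symm i : Y') : rightHalfPlane) with hl
  have hmem := mem_closure_decomposableCone hf (l := l)
    (fun i k h => e.symm.injective (Subtype.ext (Subtype.ext h))) (fun i => Subtype.coe_prop _)
  obtain ⟨H, ⟨K, hK, hsum⟩, hdist⟩ := Metric.mem_closure_iff.1 hmem ε hε
  have hJ : ∀ᶠ J in atTop, ∀ i k, ‖(1 - f (l i) * conj (f (l k))) - ∑ j ∈ Finset.range J,
      (1 - (prm j : ℂ) ^ (-l i) * conj ((prm j : ℂ) ^ (-l k))) * K j i k‖ < ε := by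
    rw [eventually_all]
    intro i
    rw [eventually_all]
    intro k
    have ht := ((hsum i k).tendsto_sum_nat.const_sub (1 - f (l i) * conj (f (l k)))).norm
    refine ht.eventually_lt_const ?_
    rw [← dist_eq_norm]
    exact (dist_le_pi_dist _ _ k).trans_lt ((dist_le_pi_dist _ _ i).trans_lt hdist)
  obtain ⟨J, hJ⟩ := hJ.exists
  set p : rightHalfPlane → Fin Y'.card := fun s =>
    if h : s ∈ Y' then e ⟨s, h⟩ else e ⟨⟨1, h1mem⟩, Finset.mem_insert_self _ _⟩
  have hp : ∀ s ∈ Y, l (p s) = s := fun s hs => by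
    have : s ∈ Y' := Finset.mem_insert_of_mem hs
    simp [l, p, this]
  refine ⟨J, fun j => if j < J then (K j).submatrix p p else 0, fun j => ?_, fun j hj => ?_,
    fun s hs w hw => ?_⟩
  · dsimp only
    split_ifs
    exacts [(hK j).submatrix p, Matrix.PosSemidef.zero]
  · simp [not_lt.2 hj]
  · have := hJ (p s) (p w)
    rw [hp s hs, hp w hw] at this
    refine lt_of_eq_of_lt ?_ this
    congr 2
    refine Finset.sum_congr rfl fun j hj => ?_
    simp only [if_pos (Finset.mem_range.1 hj)]
    rfl

/-! ### Compactness: from finite sets to the half plane -/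

/-- The `2 × 2` minor gives `|M s w|² ≤ M s s * M w w`; the sum on the right is cruder but adds well
over `j`. -/
theorem norm_apply_le_of_posSemidef {ι : Type*} {M : Matrix ι ι ℂ} (hM : M.PosSemidef) (s w : ι) :
    ‖M s w‖ ≤ (M s s).re + (M w w).re := by
  have h := (hM.submatrix ![s, w]).det_nonneg
  rw [Matrix.det_fin_two] at h
  simp only [Matrix.submatrix_apply, Matrix.cons_val_zero, Matrix.cons_val_one] at h
  have hd : ∀ i, M i i = ((M i i).re : ℂ) ∧ 0 ≤ (M i i).re := fun i => by
    have := Complex.le_def.1 (hM.diag_nonneg (i := i))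
    exact ⟨Complex.ext rfl (by simpa using this.2.symm), this.1⟩
  have hws : M w s = conj (M s w) := (congrFun (congrFun hM.1 w) s).symm
  rw [(hd s).1, (hd w).1, hws, Complex.mul_conj'] at h
  have h' : ‖M s w‖ ^ 2 ≤ (M s s).re * (M w w).re := by exact_mod_cast sub_nonneg.1 h
  have h1 := (hd s).2
  have h2 := (hd w).2
  exact abs_le_of_sq_le_sq' (by nlinarith) (by linarith) |>.2

theorem exists_tendsto_of_bounded {κ : Type*} (U : Ultrafilter κ) {u : κ → ℂ} {B : ℝ}
    (h : ∀ᶠ i in (U : Filter κ), ‖u i‖ ≤ B) : ∃ z, Tendsto u U (𝓝 z) := by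
  obtain ⟨z, -, hz⟩ := (isCompact_closedBall (0 : ℂ) B).ultrafilter_le_nhds (U.map u) (by
    rw [le_principal_iff]
    change u ⁻¹' Metric.closedBall 0 B ∈ (U : Filter κ)
    filter_upwards [h] with i hi
    simpa using hi)
  exact ⟨z, hz⟩

/-- If a kernel is, on every finite set, a limit of sums `∑ (1 - q_j(s) conj(q_j(w))) K_j(s, w)`,
then it is such a sum. -/
theorem exists_decomposition_of_approx {X : Type*} (q : ℕ → X → ℂ)
    (hq1 : ∀ s, ∃ ρ < 1, ∀ j, ‖q j s‖ ≤ ρ)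
    (hq0 : ∀ s, Tendsto (fun j => q j s) atTop (𝓝 0)) (Δ : X → X → ℂ)
    (h : ∀ (Y : Finset X) (ε : ℝ), 0 < ε → ∃ (J : ℕ) (K : ℕ → Matrix X X ℂ),
      (∀ j, (K j).PosSemidef) ∧ (∀ j, J ≤ j → K j = 0) ∧ ∀ s ∈ Y, ∀ w ∈ Y,
        ‖Δ s w - ∑ j ∈ Finset.range J, (1 - q j s * conj (q j w)) * K j s w‖ < ε) :
    ∃ K : ℕ → Matrix X X ℂ, (∀ j, (K j).PosSemidef) ∧
      (∀ s w, HasSum (fun j => (1 - q j s * conj (q j w)) * K j s w) (Δ s w)) ∧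
      ∀ s, Summable fun j => K j s s := by
  classical
  choose ρ hρ1 hρ using hq1
  have hρ0 : ∀ s, 0 ≤ ρ s := fun s => (norm_nonneg _).trans (hρ s 0)
  have hq : ∀ j s, ‖q j s‖ < 1 := fun j s => (hρ s j).trans_lt (hρ1 s)
  have hrho : ∀ s, 0 < 1 - ρ s ^ 2 := fun s => by
    have := pow_lt_one₀ (hρ0 s) (hρ1 s) two_ne_zero
    linarith
  choose J K hK hKJ hΔ using fun i : Finset X × ℕ =>
    h i.1 (1 / ((i.2 : ℝ) + 1)) (by positivity)
  -- The index `(Y, n)` stands for accuracy `1/(n+1)` on `Y`. An ultrafilter makes all bounded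
  -- entries converge at once, even for uncountable `X`.
  set U : Ultrafilter (Finset X × ℕ) := Ultrafilter.of atTop
  have hU : (U : Filter (Finset X × ℕ)) ≤ atTop := Ultrafilter.of_le _
  have hmem : ∀ s, ∀ᶠ i in (U : Filter (Finset X × ℕ)), s ∈ i.1 := fun s => by
    refine hU ?_
    filter_upwards [eventually_ge_atTop (({s}, 0) : Finset X × ℕ)] with i hi
    exact hi.1 (Finset.mem_singleton_self s)
  -- bounds on the diagonal
  have hre : ∀ i j s, 0 ≤ (K i j s s).re := fun i j s =>
    (Complex.le_def.1 ((hK i j).diag_nonneg (i := s))).1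
  -- On the diagonal each factor is at least `1 - ρ²`, and the `1` bounds the approximation error.
  set C : X → ℝ := fun s => (‖Δ s s‖ + 1) / (1 - ρ s ^ 2) with hC
  have hdiag : ∀ i s, s ∈ i.1 → ∑ j ∈ Finset.range (J i), (K i j s s).re ≤ C s := by
    intro i s hs
    rw [hC, le_div_iff₀ (hrho s), Finset.sum_mul]
    have h1 : ∑ j ∈ Finset.range (J i), (K i j s s).re * (1 - ρ s ^ 2) ≤
        (∑ j ∈ Finset.range (J i), (1 - q j s * conj (q j s)) * K i j s s).re := by
      rw [Complex.re_sum]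
      refine Finset.sum_le_sum fun j _ => ?_
      have e : (1 - q j s * conj (q j s)) = ((1 - ‖q j s‖ ^ 2 : ℝ) : ℂ) := by
        rw [Complex.mul_conj']; push_cast; rfl
      rw [e, Complex.re_ofReal_mul, mul_comm]
      have := pow_le_pow_left₀ (norm_nonneg _) (hρ s j) 2
      exact mul_le_mul_of_nonneg_right (by linarith) (hre i j s)
    refine h1.trans ((Complex.re_le_norm _).trans ?_)
    have h2 := hΔ i s hs s hs
    have h3 : 1 / ((i.2 : ℝ) + 1) ≤ 1 := by
      rw [div_le_one (by positivity)]; linarith [Nat.cast_nonneg (α := ℝ) i.2]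
    have h4 := norm_sub_norm_le (∑ j ∈ Finset.range (J i), (1 - q j s * conj (q j s)) * K i j s s)
      (Δ s s)
    rw [norm_sub_rev] at h4
    linarith
  have hsub : ∀ i s, s ∈ i.1 → ∀ F : Finset ℕ, ∑ j ∈ F, (K i j s s).re ≤ C s := by
    intro i s hs F
    refine le_trans ?_ (hdiag i s hs)
    have hsum : HasSum (fun j => (K i j s s).re) (∑ j ∈ Finset.range (J i), (K i j s s).re) :=
      hasSum_sum_of_ne_finset_zero fun j hj => by
        rw [hKJ i j (by simpa using hj)]; rfl
    exact sum_le_hasSum F (fun j _ => hre i j s) hsum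
  have hnorm : ∀ i s w, s ∈ i.1 → w ∈ i.1 → ∀ F : Finset ℕ,
      ∑ j ∈ F, ‖K i j s w‖ ≤ C s + C w := fun i s w hs hw F =>
    calc ∑ j ∈ F, ‖K i j s w‖ ≤ ∑ j ∈ F, ((K i j s s).re + (K i j w w).re) :=
          Finset.sum_le_sum fun j _ => norm_apply_le_of_posSemidef (hK i j) s w
      _ ≤ C s + C w := by
          rw [Finset.sum_add_distrib]
          exact add_le_add (hsub i s hs F) (hsub i w hw F)
  -- limit kernels
  have hlim : ∀ j s w, ∃ z, Tendsto (fun i => K i j s w) U (𝓝 z) := fun j s w => by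
    refine exists_tendsto_of_bounded U (B := C s + C w) ?_
    filter_upwards [hmem s, hmem w] with i hs hw
    simpa using hnorm i s w hs hw {j}
  choose k hk using hlim
  have hkpsd : ∀ j, (Matrix.of (k j)).PosSemidef := fun j =>
    posSemidef_of_tendsto (Eventually.of_forall fun i => hK i j) (hk j)
  have hkre : ∀ j s, 0 ≤ (k j s s).re := fun j s =>
    (Complex.le_def.1 ((hkpsd j).diag_nonneg (i := s))).1
  have hksum : ∀ s, Summable fun j => (k j s s).re := fun s => by
    refine summable_of_sum_le (c := C s) (fun j => hkre j s) fun F => ?_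
    refine le_of_tendsto (tendsto_finsetSum F fun j _ =>
      (Complex.continuous_re.tendsto _).comp (hk j s s)) ?_
    filter_upwards [hmem s] with i hs using hsub i s hs F
  have hksum' : ∀ s w, Summable fun j => k j s w := fun s w =>
    Summable.of_norm_bounded ((hksum s).add (hksum w)) fun j =>
      norm_apply_le_of_posSemidef (hkpsd j) s w
  have hasum : ∀ s w, Summable fun j => (1 - q j s * conj (q j w)) * k j s w := fun s w => by
    refine Summable.of_norm_bounded ((hksum' s w).norm.mul_left 2) fun j => ?_
    rw [norm_mul]
    gcongr
    refine (norm_sub_le _ _).trans ?_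
    rw [norm_one, norm_mul, RCLike.norm_conj]
    have := mul_le_one₀ (hq j s).le (norm_nonneg _) (hq j w).le
    linarith
  -- tails
  have htail : ∀ m s w, ∃ z, Tendsto (fun i => ∑ j ∈ Finset.range (J i), K i (m + j) s w) U (𝓝 z) :=
    fun m s w => by
    refine exists_tendsto_of_bounded U (B := C s + C w) ?_
    filter_upwards [hmem s, hmem w] with i hs hw
    refine (norm_sum_le _ _).trans ?_
    have := hnorm i s w hs hw ((Finset.range (J i)).map (addLeftEmbedding m))
    rwa [Finset.sum_map] at this
  choose T hT using htail
  have hTpsd : ∀ m, (Matrix.of (T m)).PosSemidef := fun m => by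
    refine posSemidef_of_tendsto (l := (U : Filter (Finset X × ℕ)))
      (M := fun i => ∑ j ∈ Finset.range (J i), K i (m + j))
      (Eventually.of_forall fun i => Matrix.posSemidef_sum _ fun j _ => hK i (m + j))
      fun s w => ?_
    simpa only [Matrix.sum_apply, Matrix.of_apply] using hT m s w
  have hΔlim : ∀ s w, Tendsto (fun i => ∑ j ∈ Finset.range (J i),
      (1 - q j s * conj (q j w)) * K i j s w) U (𝓝 (Δ s w)) := fun s w => by
    rw [tendsto_iff_norm_sub_tendsto_zero]
    have h1 : Tendsto (fun i : Finset X × ℕ => 1 / ((i.2 : ℝ) + 1)) U (𝓝 0) :=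
      (tendsto_one_div_add_atTop_nhds_zero_nat.comp
        (tendsto_snd.mono_left prod_atTop_atTop_eq.ge)).mono_left hU
    refine squeeze_zero' (Eventually.of_forall fun _ => norm_nonneg _) ?_ h1
    filter_upwards [hmem s, hmem w] with i hs hw
    rw [norm_sub_rev]
    exact (hΔ i s hs w hw).le
  -- On the tail `q_j` is small, so replacing `1 - q_j conj(q_j)` by `1` costs at most `ε` times the
  -- total mass.
  have hrem : ∀ s w (ε : ℝ) m, (∀ j, m ≤ j → ‖q j s‖ ≤ ε) →
      ‖Δ s w - ∑ j ∈ Finset.range m, (1 - q j s * conj (q j w)) * k j s w - T m s w‖ ≤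
        ε * (C s + C w) := by
    intro s w ε m hm
    have hε : 0 ≤ ε := (norm_nonneg _).trans (hm m le_rfl)
    refine le_of_tendsto (((hΔlim s w).sub (tendsto_finsetSum (Finset.range m) fun j _ =>
      (hk j s w).const_mul (1 - q j s * conj (q j w)))).sub (hT m s w)).norm ?_
    filter_upwards [hmem s, hmem w] with i hs hw
    have e : ∑ j ∈ Finset.range (J i), (1 - q j s * conj (q j w)) * K i j s w =
        ∑ j ∈ Finset.range m, (1 - q j s * conj (q j w)) * K i j s w +
        ∑ j ∈ Finset.range (J i), (1 - q (m + j) s * conj (q (m + j) w)) * K i (m + j) s w := by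
      rw [← Finset.sum_range_add (fun j => (1 - q j s * conj (q j w)) * K i j s w)]
      refine Finset.sum_subset (Finset.range_mono (by lia)) fun j _ hj => ?_
      rw [hKJ i j (by simpa using hj)]
      simp
    have e' : ∑ j ∈ Finset.range (J i), (1 - q j s * conj (q j w)) * K i j s w -
        ∑ j ∈ Finset.range m, (1 - q j s * conj (q j w)) * K i j s w -
        ∑ j ∈ Finset.range (J i), K i (m + j) s w =
        -∑ j ∈ Finset.range (J i), q (m + j) s * conj (q (m + j) w) * K i (m + j) s w := by
      rw [e, ← Finset.sum_neg_distrib, add_sub_cancel_left, ← Finset.sum_sub_distrib]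
      exact Finset.sum_congr rfl fun j _ => by ring
    rw [e', norm_neg]
    calc _ ≤ ∑ j ∈ Finset.range (J i), ε * ‖K i (m + j) s w‖ := by
          refine (norm_sum_le _ _).trans (Finset.sum_le_sum fun j _ => ?_)
          rw [norm_mul, norm_mul, RCLike.norm_conj]
          gcongr
          exact (mul_le_of_le_one_right (norm_nonneg _) (hq _ w).le).trans (hm _ (by lia))
      _ ≤ ε * (C s + C w) := by
          rw [← Finset.mul_sum]
          gcongr
          have := hnorm i s w hs hw ((Finset.range (J i)).map (addLeftEmbedding m))
          rwa [Finset.sum_map] at this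
  set R : Matrix X X ℂ := Matrix.of fun s w =>
    Δ s w - ∑' j, (1 - q j s * conj (q j w)) * k j s w with hR
  -- The defect `R` is the limit of the positive semi-definite tails `T m`.
  have hRpsd : R.PosSemidef := by
    refine posSemidef_of_tendsto (l := atTop) (M := fun m => Matrix.of (T m))
      (Eventually.of_forall hTpsd) fun s w => ?_
    have h1 : Tendsto (fun m => Δ s w - ∑ j ∈ Finset.range m, (1 - q j s * conj (q j w)) * k j s w)
        atTop (𝓝 (R s w)) := (hasum s w).hasSum.tendsto_sum_nat.const_sub _
    have h2 : Tendsto (fun m => Δ s w -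
        ∑ j ∈ Finset.range m, (1 - q j s * conj (q j w)) * k j s w - T m s w) atTop (𝓝 0) := by
      rw [Metric.tendsto_atTop]
      intro ε hε
      have hC0 : 0 < C s + C w + 1 := by
        have : ∀ s, 0 ≤ C s := fun s => div_nonneg (by positivity) (hrho s).le
        linarith [this s, this w]
      obtain ⟨N, hN⟩ := Metric.tendsto_atTop.1 (hq0 s) (ε / (C s + C w + 1)) (by positivity)
      refine ⟨N, fun m hm => ?_⟩
      rw [dist_zero_right]
      have h3 := hrem s w (ε / (C s + C w + 1)) m fun j hj => by
        simpa using (hN j (hm.trans hj)).le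
      refine h3.trans_lt ?_
      rw [div_mul_eq_mul_div, div_lt_iff₀ hC0]
      exact mul_lt_mul_of_pos_left (by linarith) hε
    simpa using h1.sub h2
  -- The defect is divided by `1 - q_0 conj(q_0)` through the Szegő kernel and stored in the kernel
  -- of index `0`.
  refine ⟨fun j => Matrix.of (k j) + if j = 0 then
    (Matrix.of fun s w => (1 - q 0 s * conj (q 0 w))⁻¹).hadamard R else 0, fun j => ?_,
    fun s w => ?_, fun s => ?_⟩
  · refine (hkpsd j).add ?_
    split_ifs
    exacts [(posSemidef_one_sub_inv (q 0) (hq 0)).hadamard hRpsd, Matrix.PosSemidef.zero]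
  · have h1 := (hasum s w).hasSum.add (hasSum_ite_eq 0 (R s w))
    have h2 : ∑' j, (1 - q j s * conj (q j w)) * k j s w + R s w = Δ s w := by
      rw [hR, Matrix.of_apply]; ring
    rw [h2] at h1
    refine h1.congr_fun fun j => ?_
    by_cases hj : j = 0
    · subst hj
      simp only [if_true, Matrix.add_apply, Matrix.of_apply, Matrix.hadamard_apply]
      rw [mul_add, mul_inv_cancel_left₀ (one_sub_mul_conj_ne_zero (hq 0 s) (hq 0 w))]
    · simp [hj]
  · refine (hksum' s s).add (summable_of_ne_finset_zero (s := {0}) fun j hj => ?_)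
    simp [Finset.notMem_singleton.1 hj]

theorem hasAglerDecomposition_of_satisfiesMatrixVonNeumann {f : ℂ → ℂ}
    (hf : SatisfiesMatrixVonNeumann f) : HasAglerDecomposition f := by
  classical
  obtain ⟨K, hK, hsum, hdiag⟩ := exists_decomposition_of_approx
    (fun j (s : rightHalfPlane) => (prm j : ℂ) ^ (-(s : ℂ)))
    (fun s => ⟨_, two_rpow_neg_lt_one s.2, norm_prm_cpow_le s.2⟩)
    (fun s => tendsto_prm_cpow s.2) (fun s w => 1 - f s * conj (f w))
    fun Y ε hε => exists_approx_decomposition hf Y hε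
  refine ⟨fun j s w => if h : s ∈ rightHalfPlane ∧ w ∈ rightHalfPlane then
    K j ⟨s, h.1⟩ ⟨w, h.2⟩ else 0, fun j => ?_, fun s hs w hw => ?_, fun s hs => ?_⟩
  · rw [isPSDOn_iff]
    convert hK j with s w
    simp
    rfl
  · simpa only [prm_cpow_neg_add_conj, dif_pos (And.intro hs hw)] using hsum ⟨s, hs⟩ ⟨w, hw⟩
  · simpa only [dif_pos (And.intro hs hs)] using hdiag ⟨s, hs⟩

end DirichletAgler

end

theorem theorem1p4 (f : ℂ → ℂ) (hf : DirichletAgler.MemHardyDirichlet f) :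
    List.TFAE [DirichletAgler.MemBohrAgler f,
      DirichletAgler.HasAglerDecomposition f,
      DirichletAgler.SatisfiesMatrixVonNeumann f] := by
  tfae_have 1 → 3 := DirichletAgler.satisfiesMatrixVonNeumann_of_memBohrAgler
  tfae_have 3 → 2 := DirichletAgler.hasAglerDecomposition_of_satisfiesMatrixVonNeumann
  tfae_have 2 → 1 := DirichletAgler.memBohrAgler_of_hasAglerDecomposition
  tfae_finish
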